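/- Let $\mathfrak g$ be a finite-dimensional complex reductive Lie algebra with a nondegenerate invariant symmetric bilinear form $B$. Let $\mathfrak p=\mathfrak l+\mathfrak n_+$ be a Levi decomposition of a parabolic subalgebra with abelian nilradical $\mathfrak n_+$, and let $\mathfrak g=\mathfrak n_-+\mathfrak l+\mathfrak n_+$ be the corresponding Gelfand--Naimark decomposition. (Concretely: for some $H\in\mathfrak g$ such that $\operatorname{ad}H$ is diagonalizable with real eigenvalues, $\mathfrak n_-,\mathfrak l,\mathfrak n_+$ are the sums of the eigenspaces of $\operatorname{ad}H$ for negative, zero and positive eigenvalues; every parabolic subalgebra arises in this way.) Identify $\mathfrak n_+$ with the dual space of $\mathfrak n_-$ through $B$. For a complex vector space $E$ let $\operatorname{Pol}(E)$ be the algebra of polynomial functions on $E$ and $\mathcal D(E)$ the Weyl algebra of differential operators on $E$ with polynomial coefficients. For $Y\in\mathfrak g$ and $X\in\mathfrak n_-$ let $\alpha(Y,X)\in\mathfrak l$ and $\beta(Y,X)\in\mathfrak n_-$ be the derivatives at $t=0$ of the components $p_o(e^{tY}e^X)\in\mathfrak l$ and $p_-(e^{tY}e^X)\in\mathfrak n_-$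 in the local factorization $\exp(\mathfrak n_-)\exp(\mathfrak l)\exp(\mathfrak n_+)$; that is, the $\mathfrak l$- and $\mathfrak n_-$-components of $e^{-\operatorname{ad}X}Y$. Let $(\lambda,V)$ be an $\mathfrak l$-module with dual $(\lambda^\vee,V^\vee)$, and let $\mu=\lambda^\vee\otimes\Lambda^{\mathrm{top}}\mathfrak n_+$, realized on $V^\vee$, so that $\mu(A)=\lambda^\vee(A)+\operatorname{tr}(\operatorname{ad}A|_{\mathfrak n_+})$ for $A\in\mathfrak l$. Inflate $\lambda^\vee$ to $\mathfrak p$ by letting $\mathfrak n_+$ act trivially, and put $\operatorname{ind}_{\mathfrak p}^{\mathfrak g}(\lambda^\vee)=U(\mathfrak g)\otimes_{U(\mathfrak p)}V^\vee$. Then: (i) There is a unique algebra isomorphism $\mathcal D(\mathfrak n_-)\to\mathcal D(\mathfrak n_+)$, $T\mapsto\widehat T$ (the algebraic Fourier transform), with $\widehat{\partial/\partial z_j}=-\zeta_j$ and $\widehat{z_j}=\partial/\partial\zeta_j$ for dual linear coordinates $(z_j)$ on $\mathfrak n_-$ and $(\zeta_j)$ on $\mathfrak n_+$. (ii) There is a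 unique Lie algebra homomorphism $d\pi_\mu:\mathfrak g\to\mathcal D(\mathfrak n_-)\otimes\operatorname{End}(V^\vee)$ such that $$(d\pi_\mu(Y)F)(X)=\mu(\alpha(Y,X))F(X)-(\beta(Y,\cdot)F)(X)$$ for all $Y\in\mathfrak g$, $X\in\mathfrak n_-$ and all polynomial functions $F:\mathfrak n_-\to V^\vee$ (that is, $F\in\operatorname{Pol}(\mathfrak n_-)\otimes V^\vee$), where $\beta(Y,\cdot)$ is regarded as a vector field on $\mathfrak n_-$. (iii) Let $\widehat{d\pi_\mu}:\mathfrak g\to\mathcal D(\mathfrak n_+)\otimes\operatorname{End}(V^\vee)$ be the composition of $d\pi_\mu$ with the algebraic Fourier transform on the first factor. There is a unique linear isomorphism $$F_c:\operatorname{ind}_{\mathfrak p}^{\mathfrak g}(\lambda^\vee)\to\operatorname{Pol}(\mathfrak n_+)\otimes V^\vee$$ with $F_c(X_1\cdots X_k\otimes v)=B(X_1,\cdot)\cdots B(X_k,\cdot)\otimes v$ for all $k\ge 0$, $X_1,\dots,X_k\in\mathfrak n_-$, $v\in V^\vee$, which satisfies $F_c(Y m)=\widehat{d\pi_\mu}(Y)\,F_c(m)$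 for all $Y\in\mathfrak g$ and $m\in\operatorname{ind}_{\mathfrak p}^{\mathfrak g}(\lambda^\vee)$. -/

import Mathlib

open scoped TensorProduct

attribute [local instance 100] LieRing.ofAssociativeRing

noncomputable section

/-! ## Polynomial functions, Weyl algebra, algebraic Fourier transform -/

section Weyl

variable (E : Type*) [AddCommGroup E] [Module ℂ E]

/-- The algebra of polynomial functions on the complex vector space `E`, i.e. the algebra of
functions `E → ℂ` generated by the linear functionals. -/
def polSubalgebra : Subalgebra ℂ (E → ℂ) :=
  Algebra.adjoin ℂ (Set.range fun l : Module.Dual ℂ E => (fun x => l x : E → ℂ))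

/-- `Pol(E)`: the type of polynomial functions on the complex vector space `E`. -/
def Pol : Type _ := polSubalgebra E

instance : CommRing (Pol E) := inferInstanceAs (CommRing (polSubalgebra E))

instance : Algebra ℂ (Pol E) := inferInstanceAs (Algebra ℂ (polSubalgebra E))

variable {E}

/-- The inclusion of `Pol(E)` into the algebra of all functions `E → ℂ`. -/
def Pol.toFun : Pol E →ₐ[ℂ] (E → ℂ) := (polSubalgebra E).val

theorem Pol.lineDeriv_aux {f : E → ℂ} (hf : f ∈ polSubalgebra E) (v : E) :
    (fun x => lineDeriv ℂ f x v) ∈ polSubalgebra E ∧ ∀ x, LineDifferentiableAt ℂ f x v := by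
  induction hf using Algebra.adjoin_induction with
  | mem f hf =>
    obtain ⟨l, rfl⟩ := hf
    have h : ∀ x, HasLineDerivAt ℂ (fun x => l x) (l v) x v := by
      intro x
      have h1 : HasDerivAt (fun t : ℂ => l x + t * l v) (l v) 0 := by
        simpa using ((hasDerivAt_id (0 : ℂ)).mul_const (l v)).const_add (l x)
      simpa [HasLineDerivAt] using h1
    refine ⟨?_, fun x => (h x).lineDifferentiableAt⟩
    have : (fun x => lineDeriv ℂ (fun x => l x) x v) = algebraMap ℂ (E → ℂ) (l v) := by
      funext x
      exact (h x).lineDeriv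
    rw [this]
    exact Subalgebra.algebraMap_mem _ _
  | algebraMap r =>
    have h : ∀ x, HasLineDerivAt ℂ (algebraMap ℂ (E → ℂ) r) 0 x v := by
      intro x
      simpa [HasLineDerivAt] using hasDerivAt_const (0 : ℂ) r
    refine ⟨?_, fun x => (h x).lineDifferentiableAt⟩
    have : (fun x => lineDeriv ℂ (algebraMap ℂ (E → ℂ) r) x v) = 0 := by
      funext x
      exact (h x).lineDeriv
    rw [this]
    exact Subalgebra.zero_mem _
  | add f g hf hg ihf ihg =>
    have h : ∀ x, HasLineDerivAt ℂ (f + g) (lineDeriv ℂ f x v + lineDeriv ℂ g x v) x v :=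
      fun x => HasDerivAt.add (ihf.2 x).hasLineDerivAt (ihg.2 x).hasLineDerivAt
    refine ⟨?_, fun x => (h x).lineDifferentiableAt⟩
    have : (fun x => lineDeriv ℂ (f + g) x v)
        = (fun x => lineDeriv ℂ f x v) + fun x => lineDeriv ℂ g x v := by
      funext x
      exact (h x).lineDeriv
    rw [this]
    exact Subalgebra.add_mem _ ihf.1 ihg.1
  | mul f g hf hg ihf ihg =>
    have h : ∀ x, HasLineDerivAt ℂ (f * g) (lineDeriv ℂ f x v * g x + f x * lineDeriv ℂ g x v)
        x v := by
      intro x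
      have h1 := HasDerivAt.mul (ihf.2 x).hasLineDerivAt (ihg.2 x).hasLineDerivAt
      simp only [zero_smul, add_zero] at h1
      exact h1
    refine ⟨?_, fun x => (h x).lineDifferentiableAt⟩
    have : (fun x => lineDeriv ℂ (f * g) x v)
        = (fun x => lineDeriv ℂ f x v) * g + f * fun x => lineDeriv ℂ g x v := by
      funext x
      exact (h x).lineDeriv
    rw [this]
    exact Subalgebra.add_mem _ (Subalgebra.mul_mem _ ihf.1 hg) (Subalgebra.mul_mem _ hf ihg.1)

/-- A linear functional, regarded as a polynomial function. -/
def Pol.lin (l : Module.Dual ℂ E) : Pol E :=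
  ⟨fun x => l x, Algebra.subset_adjoin ⟨l, rfl⟩⟩

/-- The directional derivative `f ↦ ∂_v f` on polynomial functions,
`(∂_v f)(x) = d/dt|_{t=0} f(x + t v)`. -/
def Pol.partialDeriv (v : E) : Module.End ℂ (Pol E) where
  toFun f := ⟨fun x => lineDeriv ℂ f.1 x v, (Pol.lineDeriv_aux f.2 v).1⟩
  map_add' f g := by
    refine Subtype.ext (funext fun x => ?_)
    exact (HasDerivAt.add ((Pol.lineDeriv_aux f.2 v).2 x).hasLineDerivAt
      ((Pol.lineDeriv_aux g.2 v).2 x).hasLineDerivAt).deriv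
  map_smul' c f := by
    refine Subtype.ext (funext fun x => ?_)
    exact (HasDerivAt.const_mul c ((Pol.lineDeriv_aux f.2 v).2 x).hasLineDerivAt).deriv

variable (E) in
/-- The algebra of differential operators on `E` with polynomial coefficients, generated by the
multiplications by linear functionals and the directional derivatives (realized faithfully on
polynomial functions). -/
def weylSubalgebra : Subalgebra ℂ (Module.End ℂ (Pol E)) :=
  Algebra.adjoin ℂ
    ((Set.range fun l : Module.Dual ℂ E => LinearMap.mulLeft ℂ (Pol.lin l)) ∪
      Set.range fun v : E => Pol.partialDeriv v)

variable (E) in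
/-- The Weyl algebra `𝒟(E)`. -/
def Weyl : Type _ := weylSubalgebra E

instance : Ring (Weyl E) := inferInstanceAs (Ring (weylSubalgebra E))

instance : Algebra ℂ (Weyl E) := inferInstanceAs (Algebra ℂ (weylSubalgebra E))

/-- The action of the Weyl algebra on polynomial functions. -/
def Weyl.toEnd : Weyl E →ₐ[ℂ] Module.End ℂ (Pol E) := (weylSubalgebra E).val

/-- Multiplication by a linear functional, as an element of the Weyl algebra. -/
def Weyl.mul (l : Module.Dual ℂ E) : Weyl E :=
  ⟨LinearMap.mulLeft ℂ (Pol.lin l), Algebra.subset_adjoin (Or.inl ⟨l, rfl⟩)⟩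

/-- The constant vector field `∂_v`, as an element of the Weyl algebra. -/
def Weyl.partialDeriv (v : E) : Weyl E :=
  ⟨Pol.partialDeriv v, Algebra.subset_adjoin (Or.inr ⟨v, rfl⟩)⟩

/-- The action of `𝒟(E) ⊗ End(W)` on `W`-valued polynomial functions `Pol(E) ⊗ W`. -/
def Weyl.act (E W : Type*) [AddCommGroup E] [Module ℂ E] [AddCommGroup W] [Module ℂ W] :
    Weyl E ⊗[ℂ] Module.End ℂ W →ₐ[ℂ] Module.End ℂ (Pol E ⊗[ℂ] W) :=
  (Module.endTensorEndAlgHom (R := ℂ) (S := ℂ) (A := ℂ) (M := Pol E) (N := W)).comp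
    (Algebra.TensorProduct.map (Weyl.toEnd (E := E)) (AlgHom.id ℂ (Module.End ℂ W)))

/-- The value `F(x)` of a `W`-valued polynomial function `F ∈ Pol(E) ⊗ W` at `x ∈ E`. -/
def Pol.evalAt {W : Type*} [AddCommGroup W] [Module ℂ W] (x : E) : Pol E ⊗[ℂ] W →ₗ[ℂ] W :=
  (TensorProduct.lid ℂ W).toLinearMap ∘ₗ
    TensorProduct.map ((LinearMap.proj x : (E → ℂ) →ₗ[ℂ] ℂ) ∘ₗ (Pol.toFun (E := E)).toLinearMap)
      LinearMap.id

/-- Let `b` be a perfect pairing of `E` and `E'`, which identifies `E'` with the dual space of `E`.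
The isomorphism `Φ : 𝒟(E) → 𝒟(E')` is the algebraic Fourier transform `T ↦ T̂` if
`∂/∂z_j ↦ -ζ_j` and `z_j ↦ ∂/∂ζ_j` for dual coordinates. Without coordinates: for `v ∈ E`, the field
`∂_v` goes to minus the multiplication by the functional `b(v, ·)` on `E'`, and for `w ∈ E'`, the
multiplication by the functional `b(·, w)` on `E` goes to `∂_w`. -/
def IsAlgFourier {E E' : Type*} [AddCommGroup E] [Module ℂ E] [AddCommGroup E'] [Module ℂ E']
    (b : E →ₗ[ℂ] E' →ₗ[ℂ] ℂ) (Φ : Weyl E ≃ₐ[ℂ] Weyl E') : Prop :=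
  (∀ v : E, Φ (Weyl.partialDeriv v) = -Weyl.mul (b v)) ∧
    ∀ w : E', Φ (Weyl.mul (b.flip w)) = Weyl.partialDeriv w

end Weyl

/-! ## Induced modules -/

section Induced

variable {𝔤 : Type*} [LieRing 𝔤] [LieAlgebra ℂ 𝔤] {W : Type*} [AddCommGroup W] [Module ℂ W]

/-- The homomorphism `U(𝔥) → U(𝔤)` induced by the inclusion. -/
def envelopingIncl (𝔥 : LieSubalgebra ℂ 𝔤) :
    UniversalEnvelopingAlgebra ℂ 𝔥 →ₐ[ℂ] UniversalEnvelopingAlgebra ℂ 𝔤 :=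
  UniversalEnvelopingAlgebra.lift ℂ ((UniversalEnvelopingAlgebra.ι ℂ).comp 𝔥.incl)

/-- The relations `u a ⊗ w = u ⊗ a w` (`u ∈ U(𝔤)`, `a ∈ U(𝔥)`, `w ∈ W`) in `U(𝔤) ⊗_ℂ W`. -/
def inducedRel (𝔥 : LieSubalgebra ℂ 𝔤) (σ : 𝔥 →ₗ⁅ℂ⁆ Module.End ℂ W) :
    Submodule (UniversalEnvelopingAlgebra ℂ 𝔤) (UniversalEnvelopingAlgebra ℂ 𝔤 ⊗[ℂ] W) :=
  Submodule.span _ {x | ∃ (u : UniversalEnvelopingAlgebra ℂ 𝔤)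
    (a : UniversalEnvelopingAlgebra ℂ 𝔥) (w : W),
      x = (u * envelopingIncl 𝔥 a) ⊗ₜ[ℂ] w
        - u ⊗ₜ[ℂ] (UniversalEnvelopingAlgebra.lift ℂ σ a w)}

/-- The induced module `ind_𝔥^𝔤(W) = U(𝔤) ⊗_{U(𝔥)} W`, a left `U(𝔤)`-module. -/
abbrev Ind (𝔥 : LieSubalgebra ℂ 𝔤) (σ : 𝔥 →ₗ⁅ℂ⁆ Module.End ℂ W) : Type _ :=
  (UniversalEnvelopingAlgebra ℂ 𝔤 ⊗[ℂ] W) ⧸ inducedRel 𝔥 σ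

/-- The element `u ⊗ w` of `U(𝔤) ⊗_{U(𝔥)} W`. -/
def Ind.mk (𝔥 : LieSubalgebra ℂ 𝔤) (σ : 𝔥 →ₗ⁅ℂ⁆ Module.End ℂ W)
    (u : UniversalEnvelopingAlgebra ℂ 𝔤) (w : W) : Ind 𝔥 σ :=
  Submodule.Quotient.mk (u ⊗ₜ[ℂ] w)

end Induced

/-! ## Parabolic subalgebras -/

section Parabolic

variable {𝔤 : Type*} [LieRing 𝔤] [LieAlgebra ℂ 𝔤]

/-- `H` is hyperbolic: `ad H` is diagonalizable with real eigenvalues. -/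
def IsHyperbolic (H : 𝔤) : Prop :=
  ⨆ r : ℝ, (LieAlgebra.ad ℂ 𝔤 H).eigenspace (r : ℂ) = ⊤

/-- The sum of the eigenspaces of `ad H` for the real eigenvalues in `S`. -/
def gr (H : 𝔤) (S : Set ℝ) : Submodule ℂ 𝔤 :=
  ⨆ r ∈ S, (LieAlgebra.ad ℂ 𝔤 H).eigenspace (r : ℂ)

theorem gr_lie_mem (H : 𝔤) {S T U : Set ℝ} (h : ∀ s ∈ S, ∀ t ∈ T, s + t ∈ U) {x y : 𝔤}
    (hx : x ∈ gr H S) (hy : y ∈ gr H T) : ⁅x, y⁆ ∈ gr H U := by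
  have key : gr H S ≤ (gr H U).comap ((LieAlgebra.ad ℂ 𝔤).toLinearMap.flip y) := by
    refine iSup₂_le fun s hs x hx => ?_
    have key2 : gr H T ≤ (gr H U).comap (LieAlgebra.ad ℂ 𝔤 x) := by
      refine iSup₂_le fun t ht y hy => ?_
      rw [Module.End.mem_eigenspace_iff] at hx hy
      simp only [LieAlgebra.ad_apply] at hx hy
      refine Submodule.mem_iSup_of_mem (s + t) (Submodule.mem_iSup_of_mem (h s hs t ht) ?_)
      rw [Module.End.mem_eigenspace_iff]
      simp only [LieAlgebra.ad_apply]
      rw [leibniz_lie, hx, hy, smul_lie, lie_smul]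
      push_cast
      rw [add_smul]
    exact key2 hy
  exact key hx

theorem gr_disjoint (H : 𝔤) {S T : Set ℝ} (h : Disjoint S T) : Disjoint (gr H S) (gr H T) :=
  iSupIndep.disjoint_biSup_biSup
    ((LieAlgebra.ad ℂ 𝔤 H).eigenspaces_iSupIndep.comp Complex.ofReal_injective) h

theorem gr_isCompl {H : 𝔤} (hH : IsHyperbolic H) (S : Set ℝ) : IsCompl (gr H S) (gr H Sᶜ) := by
  refine ⟨gr_disjoint H disjoint_compl_right, ?_⟩
  rw [codisjoint_iff, gr, gr, ← iSup_union, Set.union_compl_self]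
  simpa [IsHyperbolic] using hH

/-- The Levi subalgebra `𝔩`: the centralizer of `H`. -/
def levi (H : 𝔤) : LieSubalgebra ℂ 𝔤 :=
  { gr H {0} with lie_mem' := fun hx hy => gr_lie_mem H (by simp) hx hy }

/-- `𝔫₊`: the sum of the eigenspaces of `ad H` for the positive eigenvalues. -/
def nPlus (H : 𝔤) : LieSubalgebra ℂ 𝔤 :=
  { gr H (Set.Ioi 0) with
    lie_mem' := fun hx hy =>
      gr_lie_mem H (fun _ hs _ ht => Set.mem_Ioi.2 (add_pos hs ht)) hx hy }

/-- `𝔫₋`: the sum of the eigenspaces of `ad H` for the negative eigenvalues. -/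
def nMinus (H : 𝔤) : LieSubalgebra ℂ 𝔤 :=
  { gr H (Set.Iio 0) with
    lie_mem' := fun hx hy =>
      gr_lie_mem H (fun _ hs _ ht => Set.mem_Iio.2 (add_neg hs ht)) hx hy }

/-- The parabolic subalgebra `𝔭 = 𝔩 + 𝔫₊` given by a hyperbolic element `H` of a reductive Lie
algebra: the sum of the eigenspaces of `ad H` for the nonnegative eigenvalues. Every parabolic
subalgebra, with every Levi decomposition of it and the corresponding decomposition
`𝔤 = 𝔫₋ + 𝔩 + 𝔫₊`, is obtained in this way. -/
def parabolic (H : 𝔤) : LieSubalgebra ℂ 𝔤 :=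
  { gr H (Set.Ici 0) with
    lie_mem' := fun hx hy =>
      gr_lie_mem H (fun _ hs _ ht => Set.mem_Ici.2 (add_nonneg hs ht)) hx hy }

/-- The projection `𝔤 = 𝔫₋ ⊕ 𝔩 ⊕ 𝔫₊ → 𝔩`. -/
def projLevi {H : 𝔤} (hH : IsHyperbolic H) : 𝔤 →ₗ[ℂ] levi H :=
  Submodule.projectionOnto (gr H {0}) (gr H {0}ᶜ) (gr_isCompl hH _)

/-- The projection `𝔤 = 𝔫₋ ⊕ 𝔩 ⊕ 𝔫₊ → 𝔫₋`. -/
def projMinus {H : 𝔤} (hH : IsHyperbolic H) : 𝔤 →ₗ[ℂ] nMinus H :=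
  Submodule.projectionOnto (gr H (Set.Iio 0)) (gr H (Set.Iio 0)ᶜ) (gr_isCompl hH _)

theorem gr_mono (H : 𝔤) {S T : Set ℝ} (h : S ⊆ T) : gr H S ≤ gr H T :=
  biSup_mono fun _ hr => h hr

theorem projLevi_of_mem {H : 𝔤} (hH : IsHyperbolic H) (x : levi H) : projLevi hH (x : 𝔤) = x :=
  Submodule.projectionOnto_apply_left (gr_isCompl hH {0}) x

theorem projLevi_of_mem_nPlus {H : 𝔤} (hH : IsHyperbolic H) {x : 𝔤} (hx : x ∈ gr H (Set.Ioi 0)) :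
    projLevi hH x = 0 :=
  Submodule.projectionOnto_apply_of_mem_right (gr_isCompl hH {0})
    (gr_mono H (fun _ hr => ne_of_gt hr) hx)

theorem projLevi_of_mem_nMinus {H : 𝔤} (hH : IsHyperbolic H) {x : 𝔤}
    (hx : x ∈ gr H (Set.Iio 0)) : projLevi hH x = 0 :=
  Submodule.projectionOnto_apply_of_mem_right (gr_isCompl hH {0})
    (gr_mono H (fun _ hr => ne_of_lt hr) hx)

theorem exists_of_mem_parabolic {H : 𝔤} {x : 𝔤} (hx : x ∈ parabolic H) :
    ∃ a ∈ gr H {0}, ∃ b ∈ gr H (Set.Ioi 0), a + b = x := by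
  refine Submodule.mem_sup.1 ?_
  rw [gr, gr, ← iSup_union]
  have : ({0} ∪ Set.Ioi 0 : Set ℝ) = Set.Ici 0 := by
    ext r; simp [le_iff_eq_or_lt, eq_comm]
  rw [this]; exact hx

/-- The Lie algebra homomorphism `𝔭 → 𝔩` with kernel `𝔫₊`. -/
def parabolicToLevi {H : 𝔤} (hH : IsHyperbolic H) : parabolic H →ₗ⁅ℂ⁆ levi H :=
  { projLevi hH ∘ₗ (parabolic H).incl.toLinearMap with
    map_lie' := by
      rintro ⟨x, hx⟩ ⟨y, hy⟩
      obtain ⟨a, ha, b, hb, rfl⟩ := exists_of_mem_parabolic hx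
      obtain ⟨c, hc, d, hd, rfl⟩ := exists_of_mem_parabolic hy
      change projLevi hH ⁅a + b, c + d⁆ = ⁅projLevi hH (a + b), projLevi hH (c + d)⁆
      have e1 : projLevi hH ⁅a, d⁆ = 0 := projLevi_of_mem_nPlus hH
        (gr_lie_mem H (fun s hs t ht => by simp at *; linarith) ha hd)
      have e2 : projLevi hH ⁅b, c⁆ = 0 := projLevi_of_mem_nPlus hH
        (gr_lie_mem H (fun s hs t ht => by simp at *; linarith) hb hc)
      have e3 : projLevi hH ⁅b, d⁆ = 0 := projLevi_of_mem_nPlus hH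
        (gr_lie_mem H (fun s hs t ht => by simp at *; linarith) hb hd)
      have e4 : projLevi hH a = ⟨a, ha⟩ := projLevi_of_mem hH ⟨a, ha⟩
      have e5 : projLevi hH c = ⟨c, hc⟩ := projLevi_of_mem hH ⟨c, hc⟩
      have e6 : projLevi hH ⁅a, c⁆ = ⁅(⟨a, ha⟩ : levi H), ⟨c, hc⟩⁆ :=
        projLevi_of_mem hH ⁅(⟨a, ha⟩ : levi H), ⟨c, hc⟩⁆
      simp only [lie_add, add_lie, map_add, e1, e2, e3, e4, e5, e6,
        projLevi_of_mem_nPlus hH hb, projLevi_of_mem_nPlus hH hd, add_zero] }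

/-- `Ad(e^{-X}) Y = e^{-ad X} Y` for `ad X` nilpotent. -/
def AdExpNeg (X Y : 𝔤) : 𝔤 :=
  ∑ k ∈ Finset.range (nilpotencyClass (LieAlgebra.ad ℂ 𝔤 X)),
    ((-1 : ℂ) ^ k / (k.factorial : ℂ)) • ((LieAlgebra.ad ℂ 𝔤 X) ^ k) Y

/-- The map `α : 𝔤 × 𝔫₋ → 𝔩`, `α(Y, X) = d/dt|_{t=0} p_o(e^{tY} e^X)`. Since
`e^{tY} e^X = e^X e^{t Ad(e^{-X})Y}`, this is the `𝔩`-component of `Ad(e^{-X})Y`; see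
`eq_beta_alpha_of_factorization`. -/
def alpha {H : 𝔤} (hH : IsHyperbolic H) (Y : 𝔤) (X : nMinus H) : levi H :=
  projLevi hH (AdExpNeg (X : 𝔤) Y)

/-- The map `β : 𝔤 × 𝔫₋ → 𝔫₋`, `β(Y, X) = d/dt|_{t=0} p_-(e^{tY} e^X)`, for abelian `𝔫₋`. Since
`e^{tY} e^X = e^X e^{t Ad(e^{-X})Y}`, this is the `𝔫₋`-component of `Ad(e^{-X})Y`; see
`eq_beta_alpha_of_factorization`. -/
def beta {H : 𝔤} (hH : IsHyperbolic H) (Y : 𝔤) (X : nMinus H) : nMinus H :=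
  projMinus hH (AdExpNeg (X : 𝔤) Y)

section Factorization

variable {𝔸 : Type*} [NormedRing 𝔸] [NormedAlgebra ℂ 𝔸] [CompleteSpace 𝔸]

theorem exp_add_of_commute_complex {x y : 𝔸} (h : Commute x y) :
    NormedSpace.exp (x + y) = NormedSpace.exp x * NormedSpace.exp y := by
  let _ : NormedAlgebra ℚ 𝔸 := NormedAlgebra.restrictScalars ℚ ℂ 𝔸
  exact NormedSpace.exp_add_of_commute h

theorem mul_exp_eq_exp_mul_AdExpNeg (ρ : 𝔤 →ₗ⁅ℂ⁆ 𝔸) {X : 𝔤}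
    (hX : IsNilpotent (LieAlgebra.ad ℂ 𝔤 X)) (Y : 𝔤) :
    ρ Y * NormedSpace.exp (ρ X) = NormedSpace.exp (ρ X) * ρ (AdExpNeg X Y) := by
  set n := nilpotencyClass (LieAlgebra.ad ℂ 𝔤 X) with hn
  set c : ℕ → 𝔸 := fun k => ρ (((LieAlgebra.ad ℂ 𝔤 X) ^ k) Y) with hc
  have hcn : c n = 0 := by
    simp [hc, hn, pow_nilpotencyClass hX]
  have hcs : ∀ k, ρ X * c k - c k * ρ X = c (k + 1) := by
    intro k
    simp only [hc, pow_succ', Module.End.mul_apply, LieAlgebra.ad_apply, LieHom.map_lie]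
    rw [Ring.lie_def]
  set P : ℂ → 𝔸 := fun s => ∑ k ∈ Finset.range n, ((-s) ^ k / (k.factorial : ℂ)) • c k with hP
  have hPd : ∀ s, HasDerivAt P (-(ρ X * P s - P s * ρ X)) s := by
    intro s
    have h1 : HasDerivAt P (∑ k ∈ Finset.range n,
        ((k : ℂ) * (-s) ^ (k - 1) * (-1) / (k.factorial : ℂ)) • c k) s := by
      refine HasDerivAt.fun_sum fun k _ => ?_
      exact ((((hasDerivAt_id s).neg).pow k).div_const _).smul_const _
    convert h1 using 1
    simp only [hP, Finset.mul_sum, Finset.sum_mul, mul_smul_comm, smul_mul_assoc,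
      ← Finset.sum_sub_distrib, ← smul_sub, hcs, ← Finset.sum_neg_distrib]
    rcases n with _ | m
    · simp
    rw [Finset.sum_range_succ, hcn, Finset.sum_range_succ']
    simp only [smul_zero, neg_zero, add_zero, Nat.cast_zero, zero_mul, zero_div, zero_smul]
    refine Finset.sum_congr rfl fun k _ => ?_
    rw [← neg_smul]
    congr 1
    rw [Nat.factorial_succ]
    have : (k.factorial : ℂ) ≠ 0 := by exact_mod_cast k.factorial_ne_zero
    have : (k : ℂ) + 1 ≠ 0 := by exact_mod_cast k.succ_ne_zero
    push_cast
    field_simp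
  have hF : ∀ s : ℂ, HasDerivAt
      (fun s : ℂ => NormedSpace.exp (s • ρ X) * P s * NormedSpace.exp (s • (-ρ X))) 0 s := by
    intro s
    have e1 := hasDerivAt_exp_smul_const (𝕂 := ℂ) (ρ X) s
    have e2 := hasDerivAt_exp_smul_const' (𝕂 := ℂ) (-ρ X) s
    refine ((e1.mul (hPd s)).mul e2).congr_deriv ?_
    simp only [Pi.mul_apply]
    noncomm_ring
  have hconst := is_const_of_deriv_eq_zero (fun s => (hF s).differentiableAt)
    (fun s => (hF s).deriv) 0 1
  have hP0 : P 0 = ρ Y := by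
    rcases Nat.eq_zero_or_pos n with h0 | h0
    · have : c 0 = 0 := by rw [← h0]; exact hcn
      have h2 : ρ Y = 0 := by simpa [hc] using this
      simp [hP, h0, h2]
    · simp only [hP]
      rw [Finset.sum_eq_single_of_mem 0 (Finset.mem_range.2 h0)]
      · simp [hc]
      · intro k _ hk
        simp [hk]
  have hP1 : P 1 = ρ (AdExpNeg X Y) := by
    simp only [hP, AdExpNeg, map_sum, hc, ← hn]
    refine Finset.sum_congr rfl fun k _ => ?_
    exact (map_smul ρ _ _).symm
  simp only [zero_smul, one_smul, NormedSpace.exp_zero, one_mul, mul_one, hP0, hP1] at hconst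
  rw [hconst, mul_assoc, ← exp_add_of_commute_complex (Commute.neg_left (Commute.refl _))]
  simp

/-- The maps `α` and `β` are the derivatives of the local projections: realize `𝔤` in an associative
algebra and let `e^{tY} e^X = e^{a(t)} e^{b(t)} e^{c(t)}` be the factorization for small `t`, with
differentiable curves `a = p_-(e^{tY} e^X)` in `𝔫₋` through `X`, `b = p_o(e^{tY} e^X)` in `𝔩`
through `0` and `c` in `𝔫₊` through `0`. Then `a'(0) = β(Y, X)` and `b'(0) = α(Y, X)`. -/
theorem eq_beta_alpha_of_factorization {H : 𝔤} (hH : IsHyperbolic H)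
    (hab : ∀ x ∈ nMinus H, ∀ y ∈ nMinus H, ⁅x, y⁆ = 0)
    (ρ : 𝔤 →ₗ⁅ℂ⁆ 𝔸) (hρ : Function.Injective ρ) (Y : 𝔤) (X : nMinus H)
    (hX : IsNilpotent (LieAlgebra.ad ℂ 𝔤 (X : 𝔤)))
    (a : ℝ → nMinus H) (b : ℝ → levi H) (c : ℝ → nPlus H)
    (a' : nMinus H) (b' : levi H) (c' : nPlus H) (ha0 : a 0 = X) (hb0 : b 0 = 0) (hc0 : c 0 = 0)
    (ha : HasDerivAt (fun t => ρ (a t)) (ρ a') 0) (hb : HasDerivAt (fun t => ρ (b t)) (ρ b') 0)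
    (hc : HasDerivAt (fun t => ρ (c t)) (ρ c') 0)
    (h : ∀ᶠ t : ℝ in nhds 0, NormedSpace.exp (t • ρ Y) * NormedSpace.exp (ρ X) =
      NormedSpace.exp (ρ (a t)) * NormedSpace.exp (ρ (b t)) * NormedSpace.exp (ρ (c t))) :
    a' = beta hH Y X ∧ b' = alpha hH Y X := by
  have key : ∀ (f : ℝ → 𝔸) (f' : 𝔸), f 0 = 0 → HasDerivAt f f' 0 →
      HasDerivAt (fun t => NormedSpace.exp (f t)) f' 0 := by
    intro f f' h0 hf
    have h1 : HasFDerivAt (NormedSpace.exp : 𝔸 → 𝔸) (1 : 𝔸 →L[ℝ] 𝔸) (f 0) := by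
      rw [h0]; exact hasFDerivAt_exp_zero
    exact h1.comp_hasDerivAt 0 hf
  have hA : HasDerivAt (fun t => NormedSpace.exp (ρ (a t))) (NormedSpace.exp (ρ X) * ρ a') 0 := by
    have h1 := (key (fun t => ρ (a t) - ρ X) (ρ a') (by simp [ha0]) (ha.sub_const _)).const_mul
      (NormedSpace.exp (ρ X))
    have h2 : (fun t => NormedSpace.exp (ρ (a t))) =
        fun t => NormedSpace.exp (ρ X) * NormedSpace.exp (ρ (a t) - ρ X) := by
      funext t
      have hcomm : Commute (ρ X) (ρ (a t)) := by
        have h3 := LieHom.map_lie ρ (X : 𝔤) (a t : 𝔤)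
        rw [hab _ X.2 _ (a t).2, map_zero, Ring.lie_def] at h3
        exact (sub_eq_zero.1 h3.symm)
      rw [← exp_add_of_commute_complex (hcomm.sub_right (Commute.refl _))]
      simp
    rw [h2]; exact h1
  have hB := key (fun t => ρ (b t)) (ρ b') (by simp [hb0]) hb
  have hC := key (fun t => ρ (c t)) (ρ c') (by simp [hc0]) hc
  have hL : HasDerivAt (fun t : ℝ => NormedSpace.exp (t • ρ Y) * NormedSpace.exp (ρ X))
      (ρ Y * NormedSpace.exp (ρ X)) 0 := by
    refine (key (fun t => t • ρ Y) (ρ Y) (by simp) ?_).mul_const _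
    simpa using (hasDerivAt_id (0 : ℝ)).smul_const (ρ Y)
  have hR := (hA.mul hB).mul hC
  have huniq := hL.unique (hR.congr_of_eventuallyEq h)
  simp only [Pi.mul_apply, ha0, hb0, hc0, ZeroMemClass.coe_zero, map_zero, NormedSpace.exp_zero, mul_one] at huniq
  rw [mul_exp_eq_exp_mul_AdExpNeg ρ hX, ← mul_add, ← mul_add] at huniq
  have hinv := congrArg (fun z => NormedSpace.exp (-ρ X) * z) huniq
  simp only [← mul_assoc] at hinv
  rw [← exp_add_of_commute_complex (Commute.neg_left (Commute.refl _))] at hinv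
  simp only [neg_add_cancel, NormedSpace.exp_zero, one_mul, ← map_add] at hinv
  have hsum := hρ hinv
  have hm1 : projMinus hH (a' : 𝔤) = a' :=
    Submodule.projectionOnto_apply_left (gr_isCompl hH (Set.Iio 0)) a'
  have hm2 : projMinus hH (b' : 𝔤) = 0 :=
    Submodule.projectionOnto_apply_of_mem_right (gr_isCompl hH (Set.Iio 0))
      (gr_mono H (fun r hr => by simp at *; linarith) b'.2)
  have hm3 : projMinus hH (c' : 𝔤) = 0 :=
    Submodule.projectionOnto_apply_of_mem_right (gr_isCompl hH (Set.Iio 0))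
      (gr_mono H (fun r hr => by simp at *; linarith) c'.2)
  constructor
  · rw [beta, hsum, map_add, map_add, hm1, hm2, hm3, add_zero, add_zero]
  · rw [alpha, hsum, map_add, map_add, projLevi_of_mem, projLevi_of_mem_nMinus hH a'.2,
      projLevi_of_mem_nPlus hH c'.2, zero_add, add_zero]

end Factorization

/-- The action of an endomorphism `f` on the top exterior power by derivations is multiplication by
the trace of `f`. -/
theorem sum_ιMulti_update_eq_trace_smul {M : Type*} [AddCommGroup M] [Module ℂ M] {n : ℕ}
    (e : Module.Basis (Fin n) ℂ M) (f : Module.End ℂ M) :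
    ∑ i, exteriorPower.ιMulti ℂ n (Function.update e i (f (e i))) =
      LinearMap.trace ℂ M f • exteriorPower.ιMulti ℂ n e := by
  rw [LinearMap.trace_eq_matrix_trace ℂ e, Matrix.trace, Finset.sum_smul]
  refine Finset.sum_congr rfl fun i _ => ?_
  conv_lhs => rw [← e.sum_repr (f (e i))]
  rw [AlternatingMap.map_update_sum, Finset.sum_eq_single i]
  · rw [AlternatingMap.map_update_smul, Function.update_eq_self, Matrix.diag_apply,
      LinearMap.toMatrix_apply]
  · intro j _ hj
    rw [AlternatingMap.map_update_smul]
    rw [AlternatingMap.map_eq_zero_of_eq (exteriorPower.ιMulti ℂ n) _ (i := i) (j := j) _ hj.symm,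
      smul_zero]
    simp [Function.update_of_ne hj]
  · simp

/-- The endomorphism `ad A` of `𝔫₊`, for `A ∈ 𝔩`. -/
def adNPlus {H : 𝔤} (A : levi H) : Module.End ℂ (nPlus H) :=
  (LieAlgebra.ad ℂ 𝔤 (A : 𝔤)).restrict (p := (nPlus H).toSubmodule) (q := (nPlus H).toSubmodule)
    fun _ hx => gr_lie_mem H (fun s hs t ht => by simp at *; linarith) A.2 hx

variable {V : Type*} [AddCommGroup V] [Module ℂ V]

/-- The representation `λ^∨` of `𝔩` on the dual space `V^∨`, inflated to `𝔭 = 𝔩 + 𝔫₊` by letting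
`𝔫₊` act trivially. -/
def inflatedDual {H : 𝔤} (hH : IsHyperbolic H) (V : Type*) [AddCommGroup V] [Module ℂ V]
    [LieRingModule (levi H) V] [LieModule ℂ (levi H) V] :
    parabolic H →ₗ⁅ℂ⁆ Module.End ℂ (Module.Dual ℂ V) :=
  (LieModule.toEnd ℂ (levi H) (Module.Dual ℂ V)).comp (parabolicToLevi hH)

/-- The representation `μ = λ^∨ ⊗ Λ^{top} 𝔫₊` of `𝔩`, on the space `V^∨`: the action on the line
`Λ^{top} 𝔫₊` induced by the adjoint action is given by the trace, see
`sum_ιMulti_update_eq_trace_smul`. -/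
def muRep {H : 𝔤} (V : Type*) [AddCommGroup V] [Module ℂ V]
    [LieRingModule (levi H) V] [LieModule ℂ (levi H) V] (A : levi H) :
    Module.End ℂ (Module.Dual ℂ V) :=
  LieModule.toEnd ℂ (levi H) (Module.Dual ℂ V) A +
    LinearMap.trace ℂ (nPlus H) (adNPlus A) • (1 : Module.End ℂ (Module.Dual ℂ V))

/-- `dπ` is the infinitesimal principal series action `dπ_μ : 𝔤 → 𝒟(𝔫₋) ⊗ End(V^∨)`, given by
`(dπ_μ(Y) F)(X) = μ(α(Y, X)) F(X) - (β(Y, ·) F)(X)`. Here `(β(Y, ·) F)(X)` is the derivative of `F`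
at `X` in the direction of the value `β(Y, X)` of the vector field `β(Y, ·)`. -/
def IsPrincipalSeriesAction {H : 𝔤} (hH : IsHyperbolic H) (V : Type*) [AddCommGroup V] [Module ℂ V]
    [LieRingModule (levi H) V] [LieModule ℂ (levi H) V]
    (dπ : 𝔤 →ₗ⁅ℂ⁆ Weyl (nMinus H) ⊗[ℂ] Module.End ℂ (Module.Dual ℂ V)) : Prop :=
  ∀ (Y : 𝔤) (F : Pol (nMinus H) ⊗[ℂ] Module.Dual ℂ V) (X : nMinus H),
    Pol.evalAt X (Weyl.act _ _ (dπ Y) F) =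
      muRep V (alpha hH Y X) (Pol.evalAt X F) -
        Pol.evalAt X (Weyl.act _ _ (Weyl.partialDeriv (beta hH Y X) ⊗ₜ[ℂ] 1) F)

/-- The pairing of `𝔫₋` and `𝔫₊` given by a bilinear form on `𝔤`. -/
def pairing (H : 𝔤) (B : LinearMap.BilinForm ℂ 𝔤) : nMinus H →ₗ[ℂ] nPlus H →ₗ[ℂ] ℂ :=
  LinearMap.domRestrict₁₂ B (nMinus H).toSubmodule (nPlus H).toSubmodule

/-- The map `T ↦ T̂` on `End(W)`-valued differential operators, for an isomorphism `Φ` of Weyl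
algebras. -/
def Weyl.hat {E E' : Type*} [AddCommGroup E] [Module ℂ E] [AddCommGroup E'] [Module ℂ E']
    (Φ : Weyl E ≃ₐ[ℂ] Weyl E') (W : Type*) [AddCommGroup W] [Module ℂ W] :
    Weyl E ⊗[ℂ] Module.End ℂ W →ₐ[ℂ] Weyl E' ⊗[ℂ] Module.End ℂ W :=
  Algebra.TensorProduct.map (Φ : Weyl E →ₐ[ℂ] Weyl E') (AlgHom.id ℂ (Module.End ℂ W))

end Parabolic

end

noncomputable section

/-! ## The nilradicals -/

/-! The theorem reduces to a computation on the vectors `1 ⊗ v`, once the structure of the grading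
and of the Weyl algebra is known.

Structure. Reductivity forces `𝔫₋` to be abelian as well (`nMinus_abelian`): a bracket of two
homogeneous elements of `𝔫₋` lies in the radical of the Killing form, hence in the center, while `H`
scales it by a nonzero number. Invariance of `B` then gives `[𝔫₋, 𝔫₊] ⊆ 𝔩`, so `(ad X)^3 = 0` for `X
∈ 𝔫₋`, and `e^{-ad X} Y` is quadratic in `X`. Its derivative in the direction `v` is `-[v, e^{-ad X}
Y]`, and `e^{-ad X}` is an automorphism. Inserted into the commutator formula for first order
operators (`Weyl.op_eq_commutator`), these two facts say that `dπ_μ` is a homomorphism.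

Fourier transform. Inside `𝒟(𝔫₋) × 𝒟(𝔫₊)`, the pairs formed by a generator and its prescribed image
generate a subalgebra. Normal ordering shows that each projection is injective on it
(`IsWeylPair.eq_zero_of_mem_adjoin`), so it is the graph of an isomorphism.

Intertwiner. After the transform, `X ∈ 𝔫₋` multiplies by `B(X, ·)`. An element of `𝔩` acts on `1 ⊗
v` through `λ^∨`, because the trace produced by differentiating the linear coefficients cancels the
twist by `Λ^{top} 𝔫₊`. An element of `𝔫₊` kills `1 ⊗ v`, since it differentiates more often than the
degree allows. Frobenius reciprocity (`Ind.exists_linearMap`) therefore yields an equivariant map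
`F`. Its inverse comes from the homomorphism `Pol(𝔫₊) → U(𝔤)` that exists because `𝔫₋` is abelian;
the two maps are compared on spanning sets, so the Poincaré–Birkhoff–Witt theorem is not invoked. -/

/-- If `h` and `b` are endomorphisms of a finite-dimensional space with `[h, b] = c b`, `c ≠ 0`,
then `b` is nilpotent. -/
theorem Module.End.isNilpotent_of_commutator_eq_smul {M : Type*} [AddCommGroup M] [Module ℂ M]
    [FiniteDimensional ℂ M] {h b : Module.End ℂ M} {c : ℂ} (hc : c ≠ 0)
    (hb : h * b - b * h = c • b) : IsNilpotent b := by
  set D : Module.End ℂ (Module.End ℂ M) := LinearMap.mulLeft ℂ h - LinearMap.mulRight ℂ h with hD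
  have hpow : ∀ k : ℕ, D (b ^ k) = ((k : ℂ) * c) • b ^ k := by
    intro k
    induction k with
    | zero => simp [hD]
    | succ k ih =>
      have h1 : h * b ^ k - b ^ k * h = ((k : ℂ) * c) • b ^ k := ih
      have h2 : h * b ^ (k + 1) - b ^ (k + 1) * h
          = (h * b ^ k - b ^ k * h) * b + b ^ k * (h * b - b * h) := by
        rw [pow_succ]; noncomm_ring
      change h * b ^ (k + 1) - b ^ (k + 1) * h = _
      rw [h2, h1, hb, smul_mul_assoc, mul_smul_comm, ← pow_succ, ← add_smul]
      push_cast
      ring_nf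
  -- Otherwise every power `b ^ k` is an eigenvector of `ad h` for the eigenvalue `k c`; these are
  -- infinitely many distinct eigenvalues on a finite-dimensional space.
  by_contra hn
  have hne : ∀ k, b ^ k ≠ 0 := fun k hk => hn ⟨k, hk⟩
  have hev : ∀ k : ℕ, D.HasEigenvalue ((k : ℂ) * c) := fun k =>
    Module.End.hasEigenvalue_of_hasEigenvector (x := b ^ k)
      ⟨Module.End.mem_eigenspace_iff.2 (hpow k), hne k⟩
  have hinj : Function.Injective fun k : ℕ => (k : ℂ) * c := fun k l hkl => by
    have := mul_right_cancel₀ hc hkl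
    exact_mod_cast this
  exact (Set.infinite_range_of_injective hinj)
    (D.finite_hasEigenvalue.subset (Set.range_subset_iff.2 hev))

/-- Roots of the minimal polynomial are eigenvalues, so over `ℂ` the minimal polynomial is a power
of the variable. -/
theorem Module.End.isNilpotent_of_forall_hasEigenvalue {M : Type*} [AddCommGroup M] [Module ℂ M]
    [FiniteDimensional ℂ M] {c : Module.End ℂ M} (h : ∀ μ, c.HasEigenvalue μ → μ = 0) :
    IsNilpotent c := by
  have hdvd : ∀ μ, (minpoly ℂ c).IsRoot μ → μ = 0 := fun μ hμ =>
    h μ (Module.End.hasEigenvalue_of_isRoot hμ)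
  have hs := IsAlgClosed.splits (minpoly ℂ c)
  have h1 := hs.eq_prod_roots_of_monic (minpoly.monic (Algebra.IsIntegral.isIntegral c))
  have h2 : (minpoly ℂ c).roots = Multiset.replicate (minpoly ℂ c).roots.card 0 :=
    Multiset.eq_replicate_card.2 fun μ hμ => hdvd μ (Polynomial.isRoot_of_mem_roots hμ)
  rw [h2] at h1
  refine ⟨(minpoly ℂ c).roots.card, ?_⟩
  have h3 := minpoly.aeval ℂ c
  rw [h1] at h3
  simpa using h3

/-- If `b` is nilpotent and commutes with `c = [a, b]`, then `c` is nilpotent. -/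
theorem Module.End.isNilpotent_commutator {M : Type*} [AddCommGroup M] [Module ℂ M]
    [FiniteDimensional ℂ M] {a b : Module.End ℂ M} (hb : IsNilpotent b)
    (hcb : Commute (a * b - b * a) b) : IsNilpotent (a * b - b * a) := by
  set c := a * b - b * a with hc
  have hcomm : ∀ k : ℕ, a * b ^ (k + 1) - b ^ (k + 1) * a = ((k + 1 : ℕ) : ℂ) • (c * b ^ k) := by
    intro k
    induction k with
    | zero => simp [hc]
    | succ k ih =>
      have h2 : a * b ^ (k + 1 + 1) - b ^ (k + 1 + 1) * a
          = (a * b ^ (k + 1) - b ^ (k + 1) * a) * b + b ^ (k + 1) * (a * b - b * a) := by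
        rw [pow_succ]; noncomm_ring
      rw [h2, ih, ← hc, ← (hcb.pow_right (k + 1)).eq, smul_mul_assoc, mul_assoc, ← pow_succ]
      push_cast
      module
  refine Module.End.isNilpotent_of_forall_hasEigenvalue fun μ hμ => ?_
  by_contra hμ0
  obtain ⟨n, hn⟩ := hb
  obtain ⟨v, hv⟩ := hμ.exists_hasEigenvector
  have hcv : c v = μ • v := hv.apply_eq_smul
  -- The last nonzero vector among the `b ^ k v` is killed by `b`, and it is still a `μ`-eigenvector
  -- because `c` commutes with `b`.
  obtain ⟨v, hv0, hcv, hbv⟩ : ∃ v, v ≠ 0 ∧ c v = μ • v ∧ b v = 0 := by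
    have hex : ∃ k, (b ^ k) v = 0 := ⟨n, by simp [hn]⟩
    classical
    have hk := Nat.find_spec hex
    have hmin := fun m => Nat.find_min hex (m := m)
    rcases hk0 : Nat.find hex with _ | k
    · rw [hk0] at hk
      exact absurd (by simpa using hk) hv.2
    · rw [hk0] at hk
      refine ⟨(b ^ k) v, hmin k (by omega), ?_, ?_⟩
      · have := congrArg (fun f : Module.End ℂ M => f v) (hcb.pow_right k).eq
        simp only [Module.End.mul_apply] at this
        rw [this, hcv, map_smul]
      · rwa [pow_succ', Module.End.mul_apply] at hk
  -- If `v = b ^ k u`, then `b ^ (k + 1) u = 0`, and `[a, b ^ (k + 1)] = (k + 1) c b ^ k` applied to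
  -- `u` exhibits `(k + 1) μ v` in the image of `b ^ (k + 1)`. At the nilpotency exponent of `b`
  -- this forces `v = 0`.
  have hall : ∀ k : ℕ, ∃ u, v = (b ^ k) u := by
    intro k
    induction k with
    | zero => exact ⟨v, by simp⟩
    | succ k ih =>
      obtain ⟨u, hu⟩ := ih
      have h1 := congrArg (fun f : Module.End ℂ M => f u) (hcomm k)
      simp only [Module.End.mul_apply, LinearMap.sub_apply, LinearMap.smul_apply] at h1
      rw [← hu, hcv] at h1
      have h2 : (b ^ (k + 1)) u = 0 := by
        rw [pow_succ', Module.End.mul_apply, ← hu, hbv]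
      rw [h2, map_zero, zero_sub, smul_smul] at h1
      have h3 : ((k + 1 : ℕ) : ℂ) * μ ≠ 0 := mul_ne_zero (by exact_mod_cast k.succ_ne_zero) hμ0
      refine ⟨-((((k + 1 : ℕ) : ℂ) * μ)⁻¹ • a u), ?_⟩
      rw [map_neg, map_smul, ← smul_neg, h1, smul_smul, inv_mul_cancel₀ h3, one_smul]
  obtain ⟨u, hu⟩ := hall n
  exact hv0 (by simpa [hn] using hu)

/-! ### The grading by `ad H` and invariant forms -/

section Grading

variable {𝔤 : Type*} [LieRing 𝔤] [LieAlgebra ℂ 𝔤]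

theorem gr_singleton (H : 𝔤) (r : ℝ) :
    gr H {r} = (LieAlgebra.ad ℂ 𝔤 H).eigenspace (r : ℂ) := by
  simp [gr]

theorem lie_eq_smul_of_mem_gr_singleton {H x : 𝔤} {r : ℝ} (hx : x ∈ gr H {r}) :
    ⁅H, x⁆ = (r : ℂ) • x := by
  rw [gr_singleton] at hx
  exact Module.End.mem_eigenspace_iff.1 hx

/-- Induction over the homogeneous elements. -/
theorem gr_induction {H : 𝔤} {S : Set ℝ} {p : 𝔤 → Prop} (h0 : p 0)
    (hadd : ∀ x y, p x → p y → p (x + y)) (h : ∀ s ∈ S, ∀ x ∈ gr H {s}, p x) {x : 𝔤}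
    (hx : x ∈ gr H S) : p x := by
  unfold gr at hx
  refine Submodule.iSup_induction _ (motive := p) hx (fun s y hy => ?_) h0 hadd
  by_cases hs : s ∈ S
  · simp only [hs, iSup_pos] at hy
    exact h s hs y (by rwa [gr_singleton])
  · simp only [hs, iSup_false, Submodule.mem_bot] at hy
    rwa [hy]

variable {B : LinearMap.BilinForm ℂ 𝔤}

/-- Invariance under `H` gives `(s + t) B(x, y) = 0` in degrees `s` and `t`: an invariant form pairs
degree `s` only with degree `-s`. -/
theorem lieInvariant_apply_eq_zero (hB : B.lieInvariant 𝔤) {H : 𝔤} {S T : Set ℝ}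
    (hST : ∀ s ∈ S, ∀ t ∈ T, s + t ≠ 0) {x y : 𝔤} (hx : x ∈ gr H S) (hy : y ∈ gr H T) :
    B x y = 0 := by
  refine gr_induction (p := fun x => B x y = 0) (by simp) (fun a b ha hb => by simp [ha, hb]) ?_ hx
  intro s hs x hx
  refine gr_induction (p := fun y => B x y = 0) (by simp) (fun a b ha hb => by simp [ha, hb]) ?_ hy
  intro t ht y hy
  have h1 := hB H x y
  rw [lie_eq_smul_of_mem_gr_singleton hx, lie_eq_smul_of_mem_gr_singleton hy, map_smul, map_smul,
    LinearMap.smul_apply, smul_eq_mul, smul_eq_mul] at h1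
  have h2 : ((s + t : ℝ) : ℂ) * B x y = 0 := by push_cast; linear_combination h1
  exact (mul_eq_zero.1 h2).resolve_left (by exact_mod_cast hST s hs t ht)

/-- The degrees outside `T` are already orthogonal to `x`, so nondegeneracy only has to be tested on
`T`. This is the vanishing criterion behind the later bracket relations. -/
theorem eq_zero_of_forall_gr {H : 𝔤} (hH : IsHyperbolic H) (hB : B.lieInvariant 𝔤)
    (hBn : B.SeparatingLeft) {S T : Set ℝ} (hST : ∀ s ∈ S, ∀ t, t ∉ T → s + t ≠ 0) {x : 𝔤}
    (hx : x ∈ gr H S) (h : ∀ w ∈ gr H T, B x w = 0) : x = 0 := by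
  refine hBn x fun y => ?_
  obtain ⟨a, ha, b, hb, rfl⟩ := Submodule.mem_sup.1
    ((gr_isCompl hH T).sup_eq_top ▸ Submodule.mem_top : y ∈ gr H T ⊔ gr H Tᶜ)
  rw [map_add, h a ha, lieInvariant_apply_eq_zero hB (fun s hs t ht => hST s hs t ht) hx hb,
    add_zero]

theorem lie_mem_gr_singleton {H x y : 𝔤} {s t u : ℝ} (h : s + t = u) (hx : x ∈ gr H {s})
    (hy : y ∈ gr H {t}) : ⁅x, y⁆ ∈ gr H {u} :=
  gr_lie_mem H (by rintro _ rfl _ rfl; exact h) hx hy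

theorem gr_singleton_le (H : 𝔤) {s : ℝ} {S : Set ℝ} (h : s ∈ S) : gr H {s} ≤ gr H S :=
  gr_mono H (Set.singleton_subset_iff.2 h)

/-- Here `[ad H, ad x] = r ad x` with `r ≠ 0`. -/
theorem isNilpotent_ad_of_mem_gr_singleton [FiniteDimensional ℂ 𝔤] {H x : 𝔤} {r : ℝ} (hr : r ≠ 0)
    (hx : x ∈ gr H {r}) : IsNilpotent (LieAlgebra.ad ℂ 𝔤 x) := by
  refine Module.End.isNilpotent_of_commutator_eq_smul (h := LieAlgebra.ad ℂ 𝔤 H) (c := (r : ℂ))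
    (by exact_mod_cast hr) ?_
  rw [← Ring.lie_def, ← LieHom.map_lie, lie_eq_smul_of_mem_gr_singleton hx, map_smul]

/-- If `𝔫₊` is abelian, then `[𝔤_s, 𝔤_{-t}] = 0` for `0 < s < t`. -/
theorem lie_eq_zero_of_lt {H : 𝔤} (hH : IsHyperbolic H) (hB : B.lieInvariant 𝔤)
    (hBn : B.SeparatingLeft) (habelian : ∀ x ∈ nPlus H, ∀ y ∈ nPlus H, ⁅x, y⁆ = 0) {s t : ℝ}
    (hs : 0 < s) (hst : s < t) {w z : 𝔤} (hw : w ∈ gr H {s}) (hz : z ∈ gr H {-t}) :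
    ⁅w, z⁆ = 0 := by
  -- The bracket has negative degree `s - t`, so it suffices to pair it with `w' ∈ 𝔫₊`, where `B([w,
  -- z], w') = -B(z, [w, w'])`.
  refine eq_zero_of_forall_gr hH hB hBn (S := {s + -t}) (T := Set.Ioi 0) ?_
    (lie_mem_gr_singleton rfl hw hz) fun w' hw' => ?_
  · rintro _ rfl u hu
    simp only [Set.mem_Ioi, not_lt] at hu
    linarith
  · rw [hB, habelian w (gr_singleton_le H hs hw) w' hw', map_zero, neg_zero]

/-- In a reductive Lie algebra, `𝔫₋` is abelian if `𝔫₊` is. -/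
theorem nMinus_abelian [FiniteDimensional ℂ 𝔤] [LieAlgebra.HasCentralRadical ℂ 𝔤]
    (hB : B.lieInvariant 𝔤) (hBn : B.SeparatingLeft) {H : 𝔤} (hH : IsHyperbolic H)
    (habelian : ∀ x ∈ nPlus H, ∀ y ∈ nPlus H, ⁅x, y⁆ = 0) :
    ∀ x ∈ nMinus H, ∀ y ∈ nMinus H, ⁅x, y⁆ = 0 := by
  have key : ∀ r < 0, ∀ x ∈ gr H {r}, ∀ s < 0, ∀ y ∈ gr H {s}, ⁅x, y⁆ = 0 := by
    intro r' hr x hx s' hs y hy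
    obtain ⟨r, rfl⟩ : ∃ r, r' = -r := ⟨-r', by simp⟩
    obtain ⟨s, rfl⟩ : ∃ s, s' = -s := ⟨-s', by simp⟩
    rw [neg_lt_zero] at hr hs
    have ht : 0 < r + s := add_pos hr hs
    set z := ⁅x, y⁆ with hz
    have hzm : z ∈ gr H {-(r + s)} := lie_mem_gr_singleton (by ring) hx hy
    -- In the Jacobi expansion, `[w, [z, v]]` and `[[w, v], z]` both bracket a positive degree with
    -- a negative degree of larger absolute value, so `lie_eq_zero_of_lt` kills each of them.
    have hzero : ∀ w ∈ gr H {r + s}, ∀ q, 0 < q → q < r + s → ∀ v ∈ gr H {-q},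
        ⁅⁅w, z⁆, v⁆ = 0 := by
      intro w hw q hq hq' v hv
      have e1 : ⁅w, ⁅z, v⁆⁆ = 0 := lie_eq_zero_of_lt hH hB hBn habelian ht
        (t := (r + s) + q) (by linarith) hw (lie_mem_gr_singleton (by ring) hzm hv)
      have e2 : ⁅⁅w, v⁆, z⁆ = 0 := lie_eq_zero_of_lt hH hB hBn habelian (s := (r + s) - q)
        (by linarith) (by linarith) (lie_mem_gr_singleton (by ring) hw hv) hzm
      rw [lie_lie, e1, ← lie_skew, e2, neg_zero, sub_zero]
    -- Put `A = [w, z]`, of degree zero. It kills `x` and `y`, hence `z`, so `ad A = [ad w, ad z]`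
    -- commutes with the nilpotent `ad z` and is itself nilpotent. Since `ad A` commutes with `ad
    -- H`, the trace of `ad A ad H` vanishes; by invariance this trace is a nonzero multiple of the
    -- Killing form at `(w, z)`.
    have hkill : ∀ w ∈ gr H {r + s}, killingForm ℂ 𝔤 w z = 0 := by
      intro w hw
      have hAz : ⁅⁅w, z⁆, z⁆ = 0 := by
        conv_lhs => rw [hz]
        rw [leibniz_lie, ← hz, hzero w hw r hr (by linarith) x hx,
          hzero w hw s hs (by linarith) y hy, zero_lie, lie_zero, add_zero]
      have hAH : ⁅⁅w, z⁆, H⁆ = 0 := by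
        have h0 : ⁅w, z⁆ ∈ gr H {0} := lie_mem_gr_singleton (by ring) hw hzm
        rw [← lie_skew, lie_eq_smul_of_mem_gr_singleton h0]
        simp
      have hnil : IsNilpotent (LieAlgebra.ad ℂ 𝔤 ⁅w, z⁆) := by
        rw [LieHom.map_lie, Ring.lie_def]
        refine Module.End.isNilpotent_commutator
          (isNilpotent_ad_of_mem_gr_singleton (by linarith) hzm) ?_
        rw [← Ring.lie_def, ← LieHom.map_lie, commute_iff_lie_eq, ← LieHom.map_lie, hAz, map_zero]
      have hcomm : Commute (LieAlgebra.ad ℂ 𝔤 ⁅w, z⁆) (LieAlgebra.ad ℂ 𝔤 H) := by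
        rw [commute_iff_lie_eq, ← LieHom.map_lie, hAH, map_zero]
      have h0 : killingForm ℂ 𝔤 ⁅w, z⁆ H = 0 := by
        rw [killingForm_apply_apply]
        exact (LinearMap.isNilpotent_trace_of_isNilpotent
          (hcomm.isNilpotent_mul_right hnil)).eq_zero
      have h1 : killingForm ℂ 𝔤 ⁅w, z⁆ H = killingForm ℂ 𝔤 w ⁅z, H⁆ :=
        LieModule.traceForm_apply_lie_apply ℂ 𝔤 𝔤 w z H
      rw [h0, ← lie_skew, lie_eq_smul_of_mem_gr_singleton hzm, map_neg, map_smul, smul_eq_mul] at h1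
      have h2 : ((-(r + s) : ℝ) : ℂ) ≠ 0 := by exact_mod_cast (by linarith : -(r + s) ≠ 0)
      exact (mul_eq_zero.1 (neg_eq_zero.1 h1.symm)).resolve_left h2
    -- Degrees other than `r + s` pair trivially with `z` by the grading, so `z` lies in the radical
    -- of the Killing form.
    have hrad : z ∈ LieAlgebra.radical ℂ 𝔤 := by
      refine LieAlgebra.killingCompl_top_le_radical ℂ 𝔤 ?_
      rw [LieIdeal.mem_killingCompl]
      intro v _
      obtain ⟨a, ha, b, hb, rfl⟩ := Submodule.mem_sup.1
        ((gr_isCompl hH {r + s}).sup_eq_top ▸ Submodule.mem_top :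
          v ∈ gr H {r + s} ⊔ gr H {r + s}ᶜ)
      rw [map_add, LinearMap.add_apply, hkill a ha, zero_add]
      refine lieInvariant_apply_eq_zero (B := killingForm ℂ 𝔤)
        (LieModule.traceForm_lieInvariant ℂ 𝔤 𝔤) ?_ hb hzm
      rintro u hu _ rfl h
      exact hu (by simp; linarith)
    rw [LieAlgebra.HasCentralRadical.radical_eq_center, LieModule.mem_maxTrivSubmodule] at hrad
    have h3 := hrad H
    rw [lie_eq_smul_of_mem_gr_singleton hzm] at h3
    exact (smul_eq_zero.1 h3).resolve_left (by exact_mod_cast (by linarith : -(r + s) ≠ 0))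
  intro x hx y hy
  refine gr_induction (p := fun x => ⁅x, y⁆ = 0) (by simp) (fun a b ha hb => by simp [ha, hb]) ?_ hx
  intro s hs x hx
  refine gr_induction (p := fun y => ⁅x, y⁆ = 0) (by simp) (fun a b ha hb => by simp [ha, hb]) ?_ hy
  exact fun t ht y hy => key s hs x hx t ht y hy

end Grading

/-! ## Consequences of the commutativity of the nilradicals -/

section AbelianNilradical

variable {𝔤 : Type*} [LieRing 𝔤] [LieAlgebra ℂ 𝔤]

theorem exists_triangular_decomposition {H : 𝔤} (hH : IsHyperbolic H) (Y : 𝔤) :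
    ∃ (x : nMinus H) (a : levi H) (y : nPlus H), (x : 𝔤) + a + y = Y := by
  obtain ⟨x, hx, p, hp, rfl⟩ := Submodule.mem_sup.1
    ((gr_isCompl hH (Set.Iio 0)).sup_eq_top ▸ Submodule.mem_top :
      Y ∈ gr H (Set.Iio 0) ⊔ gr H (Set.Iio 0)ᶜ)
  rw [Set.compl_Iio] at hp
  obtain ⟨a, ha, y, hy, rfl⟩ := exists_of_mem_parabolic hp
  exact ⟨⟨x, hx⟩, ⟨a, ha⟩, ⟨y, hy⟩, add_assoc _ _ _⟩

theorem projMinus_coe {H : 𝔤} (hH : IsHyperbolic H) (x : nMinus H) :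
    projMinus hH (x : 𝔤) = x :=
  Submodule.projectionOnto_apply_left (gr_isCompl hH (Set.Iio 0)) x

theorem projMinus_of_mem_parabolic {H : 𝔤} (hH : IsHyperbolic H) {x : 𝔤}
    (hx : x ∈ gr H (Set.Ici 0)) : projMinus hH x = 0 :=
  Submodule.projectionOnto_apply_of_mem_right (gr_isCompl hH (Set.Iio 0))
    (gr_mono H (fun _ hr => by simpa using hr) hx)

theorem levi_le_parabolic {H : 𝔤} (a : levi H) : (a : 𝔤) ∈ parabolic H :=
  gr_mono H (fun _ hr => by simpa using (Set.mem_singleton_iff.1 hr).ge) a.2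

theorem nPlus_le_parabolic {H : 𝔤} (y : nPlus H) : (y : 𝔤) ∈ parabolic H :=
  gr_mono H (fun _ hr => le_of_lt (Set.mem_Ioi.1 hr)) y.2

theorem projMinus_levi {H : 𝔤} (hH : IsHyperbolic H) (a : levi H) : projMinus hH (a : 𝔤) = 0 :=
  projMinus_of_mem_parabolic hH (levi_le_parabolic a)

theorem projMinus_nPlus {H : 𝔤} (hH : IsHyperbolic H) (y : nPlus H) :
    projMinus hH (y : 𝔤) = 0 :=
  projMinus_of_mem_parabolic hH (nPlus_le_parabolic y)

theorem projLevi_nMinus {H : 𝔤} (hH : IsHyperbolic H) (x : nMinus H) :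
    projLevi hH (x : 𝔤) = 0 :=
  projLevi_of_mem_nMinus hH x.2

theorem projLevi_nPlus {H : 𝔤} (hH : IsHyperbolic H) (y : nPlus H) :
    projLevi hH (y : 𝔤) = 0 :=
  projLevi_of_mem_nPlus hH y.2

theorem lie_nMinus_levi_mem {H : 𝔤} (x : nMinus H) (a : levi H) : ⁅(x : 𝔤), (a : 𝔤)⁆ ∈ nMinus H :=
  gr_lie_mem H (by rintro t ht _ rfl; simpa using ht) x.2 a.2

variable {B : LinearMap.BilinForm ℂ 𝔤}

theorem pairing_injective (hB : B.lieInvariant 𝔤) (hBn : B.SeparatingLeft) {H : 𝔤}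
    (hH : IsHyperbolic H) : Function.Injective (pairing H B) := by
  rw [injective_iff_map_eq_zero]
  intro x hx
  refine Subtype.ext (eq_zero_of_forall_gr hH hB hBn (T := Set.Ioi 0) ?_ x.2 fun w hw => ?_)
  · intro s hs t ht
    simp only [Set.mem_Iio, Set.mem_Ioi, not_lt] at hs ht
    linarith
  · exact congrArg (fun f : nPlus H →ₗ[ℂ] ℂ => f ⟨w, hw⟩) hx

theorem pairing_flip_injective (hBs : ∀ x y, B x y = B y x) (hB : B.lieInvariant 𝔤) (hBn : B.SeparatingLeft)
    {H : 𝔤} (hH : IsHyperbolic H) : Function.Injective (pairing H B).flip := by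
  rw [injective_iff_map_eq_zero]
  intro x hx
  refine Subtype.ext (eq_zero_of_forall_gr hH hB hBn (T := Set.Iio 0) ?_ x.2 fun w hw => ?_)
  · intro s hs t ht
    simp only [Set.mem_Iio, Set.mem_Ioi, not_lt] at hs ht
    linarith
  · have h : B w x = 0 := congrArg (fun f : nMinus H →ₗ[ℂ] ℂ => f ⟨w, hw⟩) hx
    rw [hBs, h]

theorem pairing_isPerfPair [FiniteDimensional ℂ 𝔤] (hBs : ∀ x y, B x y = B y x) (hB : B.lieInvariant 𝔤)
    (hBn : B.SeparatingLeft) {H : 𝔤} (hH : IsHyperbolic H) : (pairing H B).IsPerfPair :=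
  .of_injective (pairing_injective hB hBn hH) (pairing_flip_injective hBs hB hBn hH)

/-- The setting: an invariant nondegenerate symmetric form `B`, a hyperbolic element `H`, and
abelian nilradicals `𝔫₊` and `𝔫₋`. -/
structure HasAbelianNilradicals (B : LinearMap.BilinForm ℂ 𝔤) (H : 𝔤) : Prop where
  symm : ∀ x y, B x y = B y x
  inv : B.lieInvariant 𝔤
  sep : B.SeparatingLeft
  hyp : IsHyperbolic H
  plus : ∀ x ∈ nPlus H, ∀ y ∈ nPlus H, ⁅x, y⁆ = 0
  minus : ∀ x ∈ nMinus H, ∀ y ∈ nMinus H, ⁅x, y⁆ = 0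

namespace HasAbelianNilradicals

variable {H : 𝔤}

/-- `[𝔫₋, 𝔫₊] ⊆ 𝔩` if `𝔫₋` and `𝔫₊` are abelian. -/
theorem lie_nMinus_nPlus_mem (h : HasAbelianNilradicals B H) (x : nMinus H) (y : nPlus H) : ⁅(x : 𝔤), (y : 𝔤)⁆ ∈ levi H := by
  obtain ⟨u, a, v, huv⟩ := exists_triangular_decomposition h.hyp ⁅(x : 𝔤), (y : 𝔤)⁆
  -- For `w ∈ 𝔫₊`, invariance moves the bracket: `B([x, y], w) = B(x, [y, w]) = 0`. Only the
  -- `𝔫₋`-component `u` is seen by this pairing.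
  have hu : u = 0 := by
    refine pairing_injective h.inv h.sep h.hyp ?_
    rw [map_zero]
    ext w
    change B u w = 0
    have h1 : B ⁅(x : 𝔤), (y : 𝔤)⁆ w = 0 := by
      rw [← lie_skew, map_neg, LinearMap.neg_apply, h.symm, neg_eq_zero]
      have := h.inv y w x
      rw [h.plus y y.2 w w.2] at this
      simpa using this.symm
    rw [← huv, map_add, map_add, LinearMap.add_apply, LinearMap.add_apply,
      lieInvariant_apply_eq_zero h.inv _ a.2 w.2, lieInvariant_apply_eq_zero h.inv _ v.2 w.2] at h1
    · simpa using h1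
    all_goals
      intro s hs t ht
      simp at hs ht
      linarith
  -- The mirror argument: for `w ∈ 𝔫₋`, `B(w, [x, y]) = -B([x, w], y) = 0`.
  have hv : v = 0 := by
    refine pairing_flip_injective h.symm h.inv h.sep h.hyp ?_
    rw [map_zero]
    ext w
    change B w v = 0
    have h1 : B w ⁅(x : 𝔤), (y : 𝔤)⁆ = 0 := by
      have := h.inv x w y
      rw [h.minus x x.2 w w.2] at this
      simpa using this.symm
    rw [← huv, map_add, map_add, lieInvariant_apply_eq_zero h.inv _ w.2 a.2,
      lieInvariant_apply_eq_zero h.inv _ w.2 u.2] at h1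
    · simpa using h1
    all_goals
      intro s hs t ht
      simp at hs ht
      linarith
  rw [← huv, hu, hv]
  simp

/-- Brackets with `𝔫₋` move `𝔫₊` into `𝔩`, `𝔩` into `𝔫₋`, and `𝔫₋` to zero. -/
theorem lie_nMinus_cube (h : HasAbelianNilradicals B H) (x₁ x₂ x₃ : nMinus H) (Y : 𝔤) :
    ⁅(x₁ : 𝔤), ⁅(x₂ : 𝔤), ⁅(x₃ : 𝔤), Y⁆⁆⁆ = 0 := by
  obtain ⟨u, a, v, rfl⟩ := exists_triangular_decomposition h.hyp Y
  have e1 := h.minus x₃ x₃.2 u u.2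
  have e2 := h.minus x₂ x₂.2 _ (lie_nMinus_levi_mem x₃ a)
  have e3 := h.minus x₁ x₁.2 _
    (lie_nMinus_levi_mem x₂ ⟨_, lie_nMinus_nPlus_mem h x₃ v⟩)
  simp only [lie_add, e1, e2, e3, lie_zero, add_zero]

theorem AdExpNeg_eq (h : HasAbelianNilradicals B H) (X : nMinus H) (Y : 𝔤) :
    AdExpNeg (X : 𝔤) Y = Y - ⁅(X : 𝔤), Y⁆ + (1 / 2 : ℂ) • ⁅(X : 𝔤), ⁅(X : 𝔤), Y⁆⁆ := by
  have h3 : LieAlgebra.ad ℂ 𝔤 (X : 𝔤) ^ 3 = 0 := by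
    ext Y
    simpa [pow_succ] using lie_nMinus_cube h X X X Y
  have hle : nilpotencyClass (LieAlgebra.ad ℂ 𝔤 (X : 𝔤)) ≤ 3 := Nat.sInf_le h3
  -- The nilpotency class may be smaller than 3; the added terms vanish.
  have hsum : AdExpNeg (X : 𝔤) Y = ∑ k ∈ Finset.range 3,
      ((-1 : ℂ) ^ k / (k.factorial : ℂ)) • ((LieAlgebra.ad ℂ 𝔤 (X : 𝔤)) ^ k) Y := by
    refine Finset.sum_subset (Finset.range_subset_range.2 hle) fun k _ hk => ?_
    rw [Finset.mem_range, not_lt] at hk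
    rw [pow_eq_zero_of_le hk (pow_nilpotencyClass ⟨3, h3⟩), LinearMap.zero_apply, smul_zero]
  rw [hsum]
  have e2 : ((LieAlgebra.ad ℂ 𝔤 (X : 𝔤)) ^ 2) Y = ⁅(X : 𝔤), ⁅(X : 𝔤), Y⁆⁆ := by
    rw [pow_two]; rfl
  rw [Finset.sum_range_succ, Finset.sum_range_succ, Finset.sum_range_one, e2]
  simp only [pow_one, pow_zero, Nat.factorial, LieAlgebra.ad_apply, Module.End.one_apply]
  norm_num
  rw [sub_eq_add_neg, lie_skew]

/-- The exponential of a nilpotent derivation is an automorphism. With the series cut at degree 2,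
the cross terms of degrees 3 and 4 must vanish: by Leibniz they are multiples of `(ad X)^3 [Y, Z]`
and `(ad X)^4 [Y, Z]`. -/
theorem AdExpNeg_lie (h : HasAbelianNilradicals B H) (X : nMinus H) (Y Z : 𝔤) :
    AdExpNeg (X : 𝔤) ⁅Y, Z⁆ = ⁅AdExpNeg (X : 𝔤) Y, AdExpNeg (X : 𝔤) Z⁆ := by
  have hY := lie_nMinus_cube h X X X Y
  have hZ := lie_nMinus_cube h X X X Z
  have e3 := lie_nMinus_cube h X X X ⁅Y, Z⁆
  have e4 := congrArg (fun z => ⁅(X : 𝔤), z⁆) e3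
  simp only [AdExpNeg_eq h]
  generalize (X : 𝔤) = a at *
  have l : ∀ y z : 𝔤, ⁅a, ⁅y, z⁆⁆ = ⁅⁅a, y⁆, z⁆ + ⁅y, ⁅a, z⁆⁆ := leibniz_lie a
  generalize hY1 : ⁅a, Y⁆ = Y₁ at *
  generalize hY2 : ⁅a, Y₁⁆ = Y₂ at *
  generalize hZ1 : ⁅a, Z⁆ = Z₁ at *
  generalize hZ2 : ⁅a, Z₁⁆ = Z₂ at *
  simp only [l Y Z, l Y Z₁, l Y Z₂, l Y₁ Z, l Y₁ Z₁, l Y₁ Z₂, l Y₂ Z, l Y₂ Z₁, lie_add, hY1,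
    hY2, hY, hZ1, hZ2, hZ, zero_lie, lie_zero, add_zero, zero_add] at e3 e4 ⊢
  simp only [add_lie, sub_lie, lie_sub, smul_lie, lie_smul]
  have f1 : ⁅Y₂, Z₁⁆ + ⁅Y₁, Z₂⁆ = 0 := by
    have : (3 : ℂ) • (⁅Y₂, Z₁⁆ + ⁅Y₁, Z₂⁆) = 0 := by
      rw [← e3]; module
    exact (smul_eq_zero.1 this).resolve_left (by norm_num)
  have f2 : ⁅Y₂, Z₂⁆ = 0 := by
    have : (6 : ℂ) • ⁅Y₂, Z₂⁆ = 0 := by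
      rw [← e4]; module
    exact (smul_eq_zero.1 this).resolve_left (by norm_num)
  rw [f2, eq_neg_of_add_eq_zero_left f1]
  module

end HasAbelianNilradicals

/-- The coordinates for `w` are the functionals `B(e i, ·)`, and invariance moves `a` from `w i` to
`e i`. In this form the trace matches the constant produced by the Fourier transformed action of
`𝔩`. -/
theorem trace_adNPlus_eq [FiniteDimensional ℂ 𝔤] (hB : B.lieInvariant 𝔤) {H : 𝔤} {ι : Type*}
    [Fintype ι] [DecidableEq ι] (e : ι → nMinus H) (w : Module.Basis ι ℂ (nPlus H))
    (hew : ∀ i j, pairing H B (e i) (w j) = if i = j then 1 else 0) (a : levi H) :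
    LinearMap.trace ℂ (nPlus H) (adNPlus a) = -∑ i, B ⁅(a : 𝔤), (e i : 𝔤)⁆ (w i) := by
  have hcoord : ∀ i y, w.repr y i = pairing H B (e i) y := by
    intro i y
    conv_rhs => rw [← w.sum_repr y]
    rw [map_sum]
    simp only [map_smul, hew, smul_eq_mul, mul_ite, mul_one, mul_zero, Finset.sum_ite_eq,
      Finset.mem_univ, if_true]
  rw [LinearMap.trace_eq_matrix_trace ℂ w, Matrix.trace, ← Finset.sum_neg_distrib]
  refine Finset.sum_congr rfl fun i _ => ?_
  rw [Matrix.diag_apply, LinearMap.toMatrix_apply, hcoord, hB, neg_neg]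
  rfl

end AbelianNilradical

/-! ## Separating families and tensor products -/

section Separating

variable {M W : Type*} [AddCommGroup M] [Module ℂ M] [AddCommGroup W] [Module ℂ W]

/-- Contraction with the coordinate functionals of a basis of `W`, of any dimension, reads off the
coefficients of `t`. -/
theorem TensorProduct.eq_zero_of_forall_lTensor_dual {t : M ⊗[ℂ] W}
    (h : ∀ ψ : Module.Dual ℂ W, ψ.lTensor M t = 0) : t = 0 := by
  classical
  let b := Module.Basis.ofVectorSpace ℂ W
  refine (TensorProduct.equivFinsuppOfBasisRight (M := M) b).map_eq_zero_iff.1 ?_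
  ext i
  have key : ∀ t : M ⊗[ℂ] W, TensorProduct.equivFinsuppOfBasisRight (M := M) b t i =
      TensorProduct.rid ℂ M ((b.coord i).lTensor M t) := by
    intro t
    induction t with
    | zero => simp
    | add x y hx hy => simp [hx, hy]
    | tmul x y => simp
  rw [key, h, map_zero]
  rfl

/-- Contracting `W` with a functional commutes with applying `φ i`, which reduces the claim to the
separation hypothesis on `M`. -/
theorem TensorProduct.eq_zero_of_forall_rTensor {ι : Type*} {N : ι → Type*}
    [∀ i, AddCommGroup (N i)] [∀ i, Module ℂ (N i)] (φ : ∀ i, M →ₗ[ℂ] N i)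
    (hφ : ∀ m, (∀ i, φ i m = 0) → m = 0) {t : M ⊗[ℂ] W} (h : ∀ i, (φ i).rTensor W t = 0) :
    t = 0 := by
  refine TensorProduct.eq_zero_of_forall_lTensor_dual fun ψ => ?_
  refine (TensorProduct.rid ℂ M).map_eq_zero_iff.1 (hφ _ fun i => ?_)
  have key : ∀ t : M ⊗[ℂ] W, φ i (TensorProduct.rid ℂ M (ψ.lTensor M t)) =
      TensorProduct.rid ℂ (N i) (ψ.lTensor (N i) ((φ i).rTensor W t)) := by
    intro t
    induction t with
    | zero => simp
    | add x y hx hy => simp only [map_add, hx, hy]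
    | tmul x y => simp
  rw [key, h, map_zero, map_zero]

theorem TensorProduct.eq_zero_of_forall_lTensor {ι : Type*} {N : ι → Type*}
    [∀ i, AddCommGroup (N i)] [∀ i, Module ℂ (N i)] (φ : ∀ i, W →ₗ[ℂ] N i)
    (hφ : ∀ m, (∀ i, φ i m = 0) → m = 0) {t : M ⊗[ℂ] W} (h : ∀ i, (φ i).lTensor M t = 0) :
    t = 0 := by
  refine (TensorProduct.comm ℂ M W).map_eq_zero_iff.1
    (TensorProduct.eq_zero_of_forall_rTensor φ hφ fun i => ?_)
  have key : ∀ t : M ⊗[ℂ] W, (φ i).rTensor M (TensorProduct.comm ℂ M W t) =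
      TensorProduct.comm ℂ M (N i) ((φ i).lTensor M t) := by
    intro t
    induction t with
    | zero => simp
    | add x y hx hy => simp only [map_add, hx, hy]
    | tmul x y => simp
  rw [key, h, map_zero]

end Separating

/-! ## Polynomial functions -/

section Polynomials

variable {E : Type*} [AddCommGroup E] [Module ℂ E]

namespace Pol

theorem toFun_injective : Function.Injective (Pol.toFun (E := E)) := Subtype.val_injective

@[simp]
theorem toFun_lin (l : Module.Dual ℂ E) (x : E) : Pol.toFun (Pol.lin l) x = l x := rfl

theorem hasLineDerivAt (f : Pol E) (x v : E) :
    HasLineDerivAt ℂ (Pol.toFun f) (Pol.toFun (Pol.partialDeriv v f) x) x v :=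
  ((Pol.lineDeriv_aux f.2 v).2 x).hasLineDerivAt

theorem induction {p : Pol E → Prop} (lin : ∀ l, p (Pol.lin l))
    (algebraMap : ∀ c : ℂ, p (algebraMap ℂ (Pol E) c)) (add : ∀ f g, p f → p g → p (f + g))
    (mul : ∀ f g, p f → p g → p (f * g)) (f : Pol E) : p f := by
  obtain ⟨f, hf⟩ := f
  induction hf using Algebra.adjoin_induction with
  | mem f hf =>
    obtain ⟨l, rfl⟩ := hf
    exact lin l
  | algebraMap r => exact algebraMap r
  | add f g hf hg ihf ihg => exact add _ _ ihf ihg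
  | mul f g hf hg ihf ihg => exact mul _ _ ihf ihg

/-- The functionals on `E`, as polynomial functions. -/
def linₗ : Module.Dual ℂ E →ₗ[ℂ] Pol E where
  toFun := Pol.lin
  map_add' _ _ := rfl
  map_smul' _ _ := rfl

@[simp] theorem linₗ_apply (l : Module.Dual ℂ E) : linₗ l = Pol.lin l := rfl

theorem partialDeriv_lin (v : E) (l : Module.Dual ℂ E) :
    Pol.partialDeriv v (Pol.lin l) = algebraMap ℂ (Pol E) (l v) := by
  refine toFun_injective (funext fun x => ?_)
  have h1 : HasDerivAt (fun t : ℂ => l (x + t • v)) (l v) 0 := by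
    simpa using ((hasDerivAt_id (0 : ℂ)).mul_const (l v)).const_add (l x)
  exact h1.deriv

theorem partialDeriv_algebraMap (v : E) (c : ℂ) :
    Pol.partialDeriv v (algebraMap ℂ (Pol E) c) = 0 :=
  toFun_injective (funext fun _ => (hasDerivAt_const (0 : ℂ) c).deriv)

theorem partialDeriv_one (v : E) : Pol.partialDeriv v (1 : Pol E) = 0 := by
  rw [← map_one (algebraMap ℂ (Pol E)), partialDeriv_algebraMap]

theorem partialDeriv_mul (v : E) (f g : Pol E) :
    Pol.partialDeriv v (f * g) = Pol.partialDeriv v f * g + f * Pol.partialDeriv v g := by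
  refine toFun_injective (funext fun x => ?_)
  have h1 := HasDerivAt.mul (hasLineDerivAt f x v) (hasLineDerivAt g x v)
  simp only [zero_smul, add_zero] at h1
  exact h1.deriv

/-- Line derivatives need not be additive in the direction in general; here additivity holds on
functionals and spreads by the Leibniz rule. -/
theorem partialDeriv_add_left (v w : E) (f : Pol E) :
    Pol.partialDeriv (v + w) f = Pol.partialDeriv v f + Pol.partialDeriv w f := by
  induction f using Pol.induction with
  | lin l => simp only [partialDeriv_lin, map_add]
  | algebraMap c => simp only [partialDeriv_algebraMap, add_zero]
  | add f g hf hg => simp only [map_add, hf, hg]; abel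
  | mul f g hf hg => simp only [partialDeriv_mul, hf, hg]; ring

theorem partialDeriv_smul_left (c : ℂ) (v : E) (f : Pol E) :
    Pol.partialDeriv (c • v) f = c • Pol.partialDeriv v f := by
  induction f using Pol.induction with
  | lin l => rw [partialDeriv_lin, partialDeriv_lin, map_smul, Algebra.algebraMap_eq_smul_one,
      Algebra.algebraMap_eq_smul_one, smul_assoc]
  | algebraMap c => simp only [partialDeriv_algebraMap, smul_zero]
  | add f g hf hg => simp only [map_add, hf, hg, smul_add]
  | mul f g hf hg => simp only [partialDeriv_mul, hf, hg, smul_mul_assoc, mul_smul_comm, smul_add]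

theorem partialDeriv_comm (v w : E) (f : Pol E) :
    Pol.partialDeriv v (Pol.partialDeriv w f) = Pol.partialDeriv w (Pol.partialDeriv v f) := by
  induction f using Pol.induction with
  | lin l => simp only [partialDeriv_lin, partialDeriv_algebraMap]
  | algebraMap c => simp only [partialDeriv_algebraMap, map_zero]
  | add f g hf hg => simp only [map_add, hf, hg]
  | mul f g hf hg => simp only [partialDeriv_mul, map_add, hf, hg]; ring

theorem exists_polynomial_line (f : Pol E) (w : E) :
    ∃ p : Polynomial ℂ, ∀ t : ℂ, p.eval t = Pol.toFun f (t • w) := by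
  induction f using Pol.induction with
  | lin l => exact ⟨Polynomial.C (l w) * Polynomial.X, fun t => by simp; ring⟩
  | algebraMap c => exact ⟨Polynomial.C c, fun t => by simp⟩
  | add f g hf hg =>
    obtain ⟨p, hp⟩ := hf
    obtain ⟨q, hq⟩ := hg
    exact ⟨p + q, fun t => by simp [hp, hq]⟩
  | mul f g hf hg =>
    obtain ⟨p, hp⟩ := hf
    obtain ⟨q, hq⟩ := hg
    exact ⟨p * q, fun t => by simp [hp, hq]⟩

/-- A polynomial function with vanishing Taylor coefficients at `0` vanishes. -/
theorem eq_zero_of_iterate_partialDeriv {f : Pol E}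
    (h : ∀ (w : E) (k : ℕ), Pol.toFun ((Pol.partialDeriv w)^[k] f) 0 = 0) : f = 0 := by
  refine toFun_injective (funext fun w => ?_)
  rw [map_zero]
  -- Restricted to the line through `w`, the `k`-th directional derivative becomes the ordinary
  -- `k`-th derivative of a polynomial in one variable; at `0` it is `k!` times the coefficient.
  have key : ∀ (k : ℕ) (f : Pol E) (p : Polynomial ℂ),
      (∀ t : ℂ, p.eval t = Pol.toFun f (t • w)) →
      ∀ t : ℂ, (Polynomial.derivative^[k] p).eval t =
        Pol.toFun ((Pol.partialDeriv w)^[k] f) (t • w) := by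
    intro k
    induction k with
    | zero => exact fun f p hp => hp
    | succ k ih =>
      intro f p hp
      rw [Function.iterate_succ_apply, Function.iterate_succ_apply]
      refine ih _ _ fun t => ?_
      have h1 : HasDerivAt (fun s : ℂ => p.eval (t + s)) ((Polynomial.derivative p).eval t) 0 := by
        have h2 := (p.hasDerivAt (t + 0)).comp_const_add t 0
        simpa using h2
      have h2 : (fun s : ℂ => p.eval (t + s)) = fun s => Pol.toFun f (t • w + s • w) := by
        funext s
        rw [hp, add_smul]
      rw [h2] at h1
      exact h1.unique (hasLineDerivAt f (t • w) w)
  obtain ⟨p, hp⟩ := exists_polynomial_line f w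
  have hp0 : p = 0 := by
    ext k
    have h1 := key k f p hp 0
    rw [zero_smul, h, ← Polynomial.coeff_zero_eq_eval_zero, Polynomial.coeff_iterate_derivative,
      zero_add, Nat.descFactorial_self, nsmul_eq_mul] at h1
    simpa using (mul_eq_zero.1 h1).resolve_left (by exact_mod_cast k.factorial_ne_zero)
  have h1 := hp 1
  rw [hp0, one_smul] at h1
  simpa using h1.symm

/-! ### The universal property of the algebra of polynomial functions -/

section Lift

variable [FiniteDimensional ℂ E] {A : Type*} [Ring A] [Algebra ℂ A]

variable (E) in
/-- Polynomials in the coordinates of a basis are the polynomial functions. -/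
def ofMvPolynomial : MvPolynomial (Fin (Module.finrank ℂ E)) ℂ →ₐ[ℂ] Pol E :=
  MvPolynomial.aeval fun i => Pol.lin ((Module.finBasis ℂ E).coord i)

/-- Injective because a polynomial over an infinite field is determined by its values, surjective
because the coordinates span the functionals. -/
theorem ofMvPolynomial_bijective : Function.Bijective (ofMvPolynomial E) := by
  constructor
  · rw [injective_iff_map_eq_zero]
    intro p hp
    refine MvPolynomial.funext fun c => ?_
    have h1 : ∀ (q : MvPolynomial (Fin (Module.finrank ℂ E)) ℂ),
        Pol.toFun (ofMvPolynomial E q) ((Module.finBasis ℂ E).equivFun.symm c) =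
          MvPolynomial.eval c q := by
      intro q
      induction q using MvPolynomial.induction_on with
      | C a => simp [ofMvPolynomial]
      | add p q hp hq => rw [map_add, map_add, map_add, Pi.add_apply, hp, hq]
      | mul_X p i hp =>
        rw [map_mul, map_mul, map_mul, Pi.mul_apply, hp]
        simp [ofMvPolynomial, Finsupp.single_apply]
    rw [← h1, hp]
    simp
  · intro f
    change f ∈ (ofMvPolynomial E).range
    induction f using Pol.induction with
    | lin l =>
      have : Pol.lin l = ∑ i, l (Module.finBasis ℂ E i) •
          Pol.lin ((Module.finBasis ℂ E).coord i) := by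
        simp only [← linₗ_apply, ← map_smul, ← map_sum]
        congr 1
        refine (Module.finBasis ℂ E).ext fun j => ?_
        simp
      rw [this]
      refine Subalgebra.sum_mem _ fun i _ => Subalgebra.smul_mem _ ?_ _
      exact ⟨MvPolynomial.X i, MvPolynomial.aeval_X _ i⟩
    | algebraMap c => exact Subalgebra.algebraMap_mem _ c
    | add f g hf hg => exact Subalgebra.add_mem _ hf hg
    | mul f g hf hg => exact Subalgebra.mul_mem _ hf hg

/-- `Pol(E)` is the free commutative algebra on the dual space of `E`. -/
theorem exists_algHom (φ : Module.Dual ℂ E →ₗ[ℂ] A) (hφ : ∀ l l', Commute (φ l) (φ l')) :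
    ∃ Φ : Pol E →ₐ[ℂ] A, ∀ l, Φ (Pol.lin l) = φ l := by
  -- `A` need not be commutative, so polynomials are evaluated in the commutative subalgebra
  -- generated by the image of `φ`.
  let S := Algebra.adjoin ℂ (Set.range φ)
  have hS : IsMulCommutative S := Algebra.isMulCommutative_adjoin ℂ (by
    rintro _ ⟨l, rfl⟩ _ ⟨l', rfl⟩
    exact hφ l l')
  let _ : CommRing S := { (inferInstance : Ring S) with mul_comm := hS.is_comm.comm }
  let e := AlgEquiv.ofBijective (ofMvPolynomial E) ofMvPolynomial_bijective
  let ψ : MvPolynomial (Fin (Module.finrank ℂ E)) ℂ →ₐ[ℂ] S :=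
    MvPolynomial.aeval fun i => ⟨φ ((Module.finBasis ℂ E).coord i), Algebra.subset_adjoin ⟨_, rfl⟩⟩
  refine ⟨(S.val.comp ψ).comp e.symm, fun l => ?_⟩
  have hX : ∀ i, ((S.val.comp ψ).comp e.symm) (Pol.lin ((Module.finBasis ℂ E).coord i)) =
      φ ((Module.finBasis ℂ E).coord i) := by
    intro i
    have : e.symm (Pol.lin ((Module.finBasis ℂ E).coord i)) = MvPolynomial.X i := by
      rw [AlgEquiv.symm_apply_eq]
      simp [e, ofMvPolynomial]
    change S.val (ψ (e.symm _)) = _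
    rw [this]
    simp [ψ]
  have : (((S.val.comp ψ).comp e.symm).toLinearMap ∘ₗ linₗ) = φ :=
    (Module.finBasis ℂ E).dualBasis.ext fun i => by
      rw [Module.Basis.coe_dualBasis]
      exact hX i
  exact congrArg (fun f : Module.Dual ℂ E →ₗ[ℂ] A => f l) this

end Lift

theorem evalAt_tmul {W : Type*} [AddCommGroup W] [Module ℂ W] (x : E) (f : Pol E) (w : W) :
    Pol.evalAt x (f ⊗ₜ[ℂ] w) = Pol.toFun f x • w := rfl

theorem eq_zero_of_evalAt {W : Type*} [AddCommGroup W] [Module ℂ W] {t : Pol E ⊗[ℂ] W}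
    (h : ∀ x, Pol.evalAt x t = 0) : t = 0 := by
  refine TensorProduct.eq_zero_of_forall_rTensor (N := fun _ : E => ℂ)
    (fun x => (LinearMap.proj x : (E → ℂ) →ₗ[ℂ] ℂ) ∘ₗ (Pol.toFun (E := E)).toLinearMap)
    (fun f hf => toFun_injective ?_) fun x => ?_
  · rw [map_zero]
    exact funext fun x => hf x
  · exact (TensorProduct.lid ℂ W).map_eq_zero_iff.1 (h x)

theorem ext_evalAt {W : Type*} [AddCommGroup W] [Module ℂ W] {t u : Pol E ⊗[ℂ] W}
    (h : ∀ x, Pol.evalAt x t = Pol.evalAt x u) : t = u :=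
  sub_eq_zero.1 (eq_zero_of_evalAt fun x => by rw [map_sub, h, sub_self])

theorem evalAt_lTensor {W W' : Type*} [AddCommGroup W] [Module ℂ W] [AddCommGroup W'] [Module ℂ W']
    (φ : W →ₗ[ℂ] W') (x : E) (t : Pol E ⊗[ℂ] W) :
    Pol.evalAt x (φ.lTensor (Pol E) t) = φ (Pol.evalAt x t) := by
  induction t with
  | zero => simp only [map_zero]
  | add s t hs ht => simp only [map_add, hs, ht]
  | tmul f w => simp only [LinearMap.lTensor_tmul, evalAt_tmul, map_smul]

end Pol

end Polynomials

/-! ## The Weyl algebra -/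

section WeylAlgebra

variable {E : Type*} [AddCommGroup E] [Module ℂ E]

namespace Weyl

theorem toEnd_injective : Function.Injective (Weyl.toEnd (E := E)) := Subtype.val_injective

@[simp]
theorem toEnd_mul (l : Module.Dual ℂ E) (f : Pol E) : Weyl.toEnd (Weyl.mul l) f = Pol.lin l * f :=
  rfl

@[simp]
theorem toEnd_partialDeriv (v : E) (f : Pol E) :
    Weyl.toEnd (Weyl.partialDeriv v) f = Pol.partialDeriv v f := rfl

theorem ext_toEnd {S T : Weyl E} (h : ∀ f, Weyl.toEnd S f = Weyl.toEnd T f) : S = T :=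
  toEnd_injective (LinearMap.ext h)

theorem induction {p : Weyl E → Prop} (mul_lin : ∀ l, p (Weyl.mul l))
    (partialDeriv : ∀ v, p (Weyl.partialDeriv v))
    (algebraMap : ∀ c : ℂ, p (algebraMap ℂ (Weyl E) c)) (add : ∀ S T, p S → p T → p (S + T))
    (mul : ∀ S T, p S → p T → p (S * T)) (T : Weyl E) : p T := by
  obtain ⟨T, hT⟩ := T
  induction hT using Algebra.adjoin_induction with
  | mem T hT =>
    obtain ⟨l, rfl⟩ | ⟨v, rfl⟩ := hT
    · exact mul_lin l
    · exact partialDeriv v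
  | algebraMap r => exact algebraMap r
  | add S T hS hT ihS ihT => exact add _ _ ihS ihT
  | mul S T hS hT ihS ihT => exact mul _ _ ihS ihT

theorem algHom_ext {A : Type*} [Semiring A] [Algebra ℂ A] {φ ψ : Weyl E →ₐ[ℂ] A}
    (h₁ : ∀ l, φ (Weyl.mul l) = ψ (Weyl.mul l))
    (h₂ : ∀ v, φ (Weyl.partialDeriv v) = ψ (Weyl.partialDeriv v)) : φ = ψ := by
  ext T
  induction T using Weyl.induction with
  | mul_lin l => exact h₁ l
  | partialDeriv v => exact h₂ v
  | algebraMap c => rw [AlgHom.commutes, AlgHom.commutes]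
  | add S T hS hT => rw [map_add, map_add, hS, hT]
  | mul S T hS hT => rw [map_mul, map_mul, hS, hT]

/-- The multiplications by functionals, linearly in the functional. -/
def mulₗ : Module.Dual ℂ E →ₗ[ℂ] Weyl E where
  toFun := Weyl.mul
  map_add' l l' := ext_toEnd fun f => add_mul (Pol.lin l) (Pol.lin l') f
  map_smul' c l := ext_toEnd fun f => smul_mul_assoc c (Pol.lin l) f

/-- The constant vector fields, linearly in the vector. -/
def partialDerivₗ : E →ₗ[ℂ] Weyl E where
  toFun := Weyl.partialDeriv
  map_add' v w := ext_toEnd fun f => Pol.partialDeriv_add_left v w f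
  map_smul' c v := ext_toEnd fun f => Pol.partialDeriv_smul_left c v f

@[simp] theorem mulₗ_apply (l : Module.Dual ℂ E) : mulₗ l = Weyl.mul l := rfl

@[simp] theorem partialDerivₗ_apply (v : E) : partialDerivₗ v = Weyl.partialDeriv v := rfl

theorem commute_mul (l l' : Module.Dual ℂ E) : Commute (Weyl.mul l) (Weyl.mul l') :=
  ext_toEnd fun f => mul_left_comm (Pol.lin l) (Pol.lin l') f

theorem commute_partialDeriv (v w : E) : Commute (Weyl.partialDeriv v) (Weyl.partialDeriv w) :=
  ext_toEnd fun f => Pol.partialDeriv_comm v w f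

theorem partialDeriv_mul_mul (v : E) (l : Module.Dual ℂ E) :
    Weyl.partialDeriv v * Weyl.mul l =
      Weyl.mul l * Weyl.partialDeriv v + algebraMap ℂ (Weyl E) (l v) := by
  refine ext_toEnd fun f => ?_
  rw [map_add, map_mul, map_mul, AlgHom.commutes]
  simp only [Module.End.mul_apply, LinearMap.add_apply, toEnd_mul, toEnd_partialDeriv,
    Pol.partialDeriv_mul, Pol.partialDeriv_lin, Module.algebraMap_end_apply]
  rw [add_comm, Algebra.smul_def]

theorem act_tmul_tmul {W : Type*} [AddCommGroup W] [Module ℂ W] (T : Weyl E) (S : Module.End ℂ W)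
    (f : Pol E) (w : W) : Weyl.act E W (T ⊗ₜ[ℂ] S) (f ⊗ₜ[ℂ] w) = Weyl.toEnd T f ⊗ₜ[ℂ] S w := rfl

/-- Polynomials separate the elements of the Weyl algebra and vectors separate endomorphisms;
testing on `f ⊗ w` combines both separations. -/
theorem act_injective (W : Type*) [AddCommGroup W] [Module ℂ W] :
    Function.Injective (Weyl.act E W) := by
  rw [injective_iff_map_eq_zero]
  intro T hT
  refine TensorProduct.eq_zero_of_forall_rTensor (N := fun _ : Pol E => Pol E)
    (fun f => LinearMap.applyₗ f ∘ₗ (Weyl.toEnd (E := E)).toLinearMap) (fun T hT => ?_) fun f => ?_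
  · exact ext_toEnd fun f => (hT f).trans (by simp)
  refine TensorProduct.eq_zero_of_forall_lTensor (N := fun _ : W => W)
    (fun w => LinearMap.applyₗ w) (fun S hS => LinearMap.ext hS) fun w => ?_
  have key : ∀ T : Weyl E ⊗[ℂ] Module.End ℂ W,
      (LinearMap.applyₗ w : Module.End ℂ W →ₗ[ℂ] W).lTensor (Pol E)
        (((LinearMap.applyₗ f : Module.End ℂ (Pol E) →ₗ[ℂ] Pol E) ∘ₗ
          (Weyl.toEnd (E := E)).toLinearMap).rTensor (Module.End ℂ W) T) =
      Weyl.act E W T (f ⊗ₜ[ℂ] w) := by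
    intro T
    induction T with
    | zero => simp only [map_zero, LinearMap.zero_apply]
    | add S T hS hT => simp only [map_add, LinearMap.add_apply, hS, hT]
    | tmul T S => rfl
  rw [key, hT, LinearMap.zero_apply]

/-- Operators with the same values on vector-valued polynomial functions are equal. -/
theorem ext_act {W : Type*} [AddCommGroup W] [Module ℂ W] {S T : Weyl E ⊗[ℂ] Module.End ℂ W}
    (h : ∀ F x, Pol.evalAt x (Weyl.act E W S F) = Pol.evalAt x (Weyl.act E W T F)) : S = T :=
  act_injective W (LinearMap.ext fun F => Pol.ext_evalAt fun x => h F x)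

end Weyl

/-! ### Weyl pairs and normal ordering -/

/-- Linear maps `X` and `D` to an algebra, with the commutation relations of the multiplications
by functionals and the constant vector fields. -/
structure IsWeylPair {A : Type*} [Ring A] [Algebra ℂ A] (X : Module.Dual ℂ E →ₗ[ℂ] A)
    (D : E →ₗ[ℂ] A) : Prop where
  commute_left : ∀ l l', Commute (X l) (X l')
  commute_right : ∀ v w, Commute (D v) (D w)
  comm : ∀ v l, D v * X l = X l * D v + algebraMap ℂ A (l v)

namespace IsWeylPair

variable {A : Type*} [Ring A] [Algebra ℂ A] {X : Module.Dual ℂ E →ₗ[ℂ] A} {D : E →ₗ[ℂ] A}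

/-- Both `[D v, ΦX ·]` and `ΦX ∘ ∂_v` obey the Leibniz rule and agree on functionals. -/
theorem mul_left_comm_pol (h : IsWeylPair X D) {ΦX : Pol E →ₐ[ℂ] A}
    (hX : ∀ l, ΦX (Pol.lin l) = X l) (v : E) (f : Pol E) :
    D v * ΦX f = ΦX f * D v + ΦX (Pol.partialDeriv v f) := by
  induction f using Pol.induction with
  | lin l => rw [hX, h.comm, Pol.partialDeriv_lin, AlgHom.commutes]
  | algebraMap c =>
    rw [AlgHom.commutes, Pol.partialDeriv_algebraMap, map_zero, add_zero, Algebra.commutes]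
  | add f g hf hg => simp only [map_add, mul_add, add_mul, hf, hg]; abel
  | mul f g hf hg =>
    rw [map_mul, ← mul_assoc, hf, add_mul, mul_assoc, hg, Pol.partialDeriv_mul, map_add, map_mul,
      map_mul, mul_add]
    noncomm_ring

/-- The dual rule: commuting a symbol in the `D v` past `X l` differentiates the symbol in the
direction `l`. -/
theorem mul_right_comm_pol [FiniteDimensional ℂ E] (h : IsWeylPair X D)
    {ΦD : Pol (Module.Dual ℂ E) →ₐ[ℂ] A}
    (hD : ∀ v, ΦD (Pol.lin (Module.Dual.eval ℂ E v)) = D v) (l : Module.Dual ℂ E)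
    (g : Pol (Module.Dual ℂ E)) :
    ΦD g * X l = X l * ΦD g + ΦD (Pol.partialDeriv l g) := by
  induction g using Pol.induction with
  | lin φ =>
    obtain ⟨v, rfl⟩ := (Module.evalEquiv ℂ E).surjective φ
    rw [Module.evalEquiv_apply, hD, h.comm, Pol.partialDeriv_lin, AlgHom.commutes]
    rfl
  | algebraMap c =>
    rw [AlgHom.commutes, Pol.partialDeriv_algebraMap, map_zero, add_zero, Algebra.commutes]
  | add f g hf hg => simp only [map_add, mul_add, add_mul, hf, hg]; abel
  | mul f g hf hg =>
    rw [map_mul, mul_assoc, hg, mul_add, ← mul_assoc, hf, Pol.partialDeriv_mul, map_add, map_mul,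
      map_mul, add_mul]
    noncomm_ring

/-- The canonical homomorphism from an algebra generated by a Weyl pair to the Weyl algebra is
injective. -/
theorem eq_zero_of_mem_adjoin [FiniteDimensional ℂ E] (h : IsWeylPair X D) {θ : A →ₐ[ℂ] Weyl E}
    (hθX : ∀ l, θ (X l) = Weyl.mul l) (hθD : ∀ v, θ (D v) = Weyl.partialDeriv v) {a : A}
    (ha : a ∈ Algebra.adjoin ℂ (Set.range X ∪ Set.range D)) (h0 : θ a = 0) : a = 0 := by
  obtain ⟨ΦX, hX⟩ := Pol.exists_algHom X h.commute_left
  obtain ⟨ΦD, hD'⟩ := Pol.exists_algHom (E := Module.Dual ℂ E)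
    (D ∘ₗ (Module.evalEquiv ℂ E).symm.toLinearMap) fun l l' => h.commute_right _ _
  have hD : ∀ v, ΦD (Pol.lin (Module.Dual.eval ℂ E v)) = D v := fun v => by
    rw [hD']
    exact congrArg D ((Module.evalEquiv ℂ E).symm_apply_apply v)
  -- Normal ordering: coefficients on the left, constant-coefficient symbols on the right. The range
  -- contains `1` and is stable under left multiplication by the generators, so it contains `a`.
  let N : Pol E ⊗[ℂ] Pol (Module.Dual ℂ E) →ₗ[ℂ] A :=
    TensorProduct.lift ((LinearMap.mul ℂ A).compl₁₂ ΦX.toLinearMap ΦD.toLinearMap)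
  have hN : ∀ f g, N (f ⊗ₜ g) = ΦX f * ΦD g := fun f g => rfl
  have hNX : ∀ l t, X l * N t ∈ LinearMap.range N := by
    intro l t
    induction t with
    | zero => simp
    | add s t hs ht => rw [map_add, mul_add]; exact Submodule.add_mem _ hs ht
    | tmul f g => exact ⟨(Pol.lin l * f) ⊗ₜ g, by rw [hN, hN, map_mul, hX, mul_assoc]⟩
  have hND : ∀ v t, D v * N t ∈ LinearMap.range N := by
    intro v t
    induction t with
    | zero => simp
    | add s t hs ht => rw [map_add, mul_add]; exact Submodule.add_mem _ hs ht
    | tmul f g =>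
      refine ⟨f ⊗ₜ (Pol.lin (Module.Dual.eval ℂ E v) * g) + Pol.partialDeriv v f ⊗ₜ g, ?_⟩
      rw [map_add, hN, hN, hN, map_mul, hD, ← mul_assoc (D v), h.mul_left_comm_pol hX, add_mul,
        mul_assoc]
  have hleft : ∀ a ∈ Algebra.adjoin ℂ (Set.range X ∪ Set.range D), ∀ t,
      a * N t ∈ LinearMap.range N := by
    intro a ha
    induction ha using Algebra.adjoin_induction with
    | mem a ha =>
      obtain ⟨l, rfl⟩ | ⟨v, rfl⟩ := ha
      · exact hNX l
      · exact hND v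
    | algebraMap c => exact fun t => ⟨c • t, by rw [map_smul, Algebra.smul_def]⟩
    | add a b _ _ iha ihb => exact fun t => by rw [add_mul]; exact Submodule.add_mem _ (iha t) (ihb t)
    | mul a b _ _ iha ihb =>
      intro t
      obtain ⟨u, hu⟩ := ihb t
      rw [mul_assoc, ← hu]
      exact iha u
  obtain ⟨t, rfl⟩ : a ∈ LinearMap.range N := by
    have := hleft a ha (1 ⊗ₜ 1)
    rwa [hN, map_one, map_one, mul_one, mul_one] at this
  -- The commutator with `X l` differentiates the symbol. Hence the kernel of `θ ∘ N` is stable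
  -- under derivatives in the second variable.
  have hder : ∀ l t, N ((Pol.partialDeriv l).lTensor (Pol E) t) = N t * X l - X l * N t := by
    intro l t
    induction t with
    | zero => simp
    | add s t hs ht => simp only [map_add, add_mul, mul_add, hs, ht]; abel
    | tmul f g =>
      have h1 : ΦX f * X l = X l * ΦX f := by rw [← hX, ← map_mul, ← map_mul, mul_comm]
      rw [LinearMap.lTensor_tmul, hN, hN, ← mul_assoc, ← h1, mul_assoc, mul_assoc,
        h.mul_right_comm_pol hD, mul_add, add_sub_cancel_left]
  -- Applied to the constant polynomial `1`, a normally ordered operator returns its symbol at the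
  -- origin of the second variable, because all derivatives kill `1`.
  have hker : ∀ t, θ (N t) = 0 → ((LinearMap.proj 0 : (Module.Dual ℂ E → ℂ) →ₗ[ℂ] ℂ) ∘ₗ
      (Pol.toFun (E := Module.Dual ℂ E)).toLinearMap).lTensor (Pol E) t = 0 := by
    intro t ht
    have hθΦX : ∀ f p, Weyl.toEnd (θ (ΦX f)) p = f * p := by
      intro f
      induction f using Pol.induction with
      | lin l => exact fun p => by rw [hX, hθX]; rfl
      | algebraMap c =>
        intro p
        rw [AlgHom.commutes, AlgHom.commutes, AlgHom.commutes, Module.algebraMap_end_apply,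
          Algebra.smul_def]
      | add f g hf hg =>
        intro p
        rw [map_add, map_add, map_add, LinearMap.add_apply, hf, hg, add_mul]
      | mul f g hf hg =>
        intro p
        rw [map_mul, map_mul, map_mul, Module.End.mul_apply, hf, hg, mul_assoc]
    have hθΦD : ∀ g, Weyl.toEnd (θ (ΦD g)) 1 = Pol.toFun g 0 • 1 := by
      intro g
      induction g using Pol.induction with
      | lin φ =>
        obtain ⟨v, rfl⟩ := (Module.evalEquiv ℂ E).surjective φ
        rw [Module.evalEquiv_apply, hD, hθD, Weyl.toEnd_partialDeriv, Pol.partialDeriv_one]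
        simp
      | algebraMap c =>
        rw [AlgHom.commutes, AlgHom.commutes, AlgHom.commutes, Module.algebraMap_end_apply,
          AlgHom.commutes]
        rfl
      | add f g hf hg =>
        rw [map_add, map_add, map_add, map_add, LinearMap.add_apply, hf, hg, Pi.add_apply, add_smul]
      | mul f g hf hg =>
        rw [map_mul, map_mul, map_mul, map_mul, Module.End.mul_apply, hg, map_smul, hf, smul_smul,
          Pi.mul_apply, mul_comm]
    have key : ∀ t, Weyl.toEnd (θ (N t)) 1 = TensorProduct.rid ℂ (Pol E)
        (((LinearMap.proj 0 : (Module.Dual ℂ E → ℂ) →ₗ[ℂ] ℂ) ∘ₗ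
          (Pol.toFun (E := Module.Dual ℂ E)).toLinearMap).lTensor (Pol E) t) := by
      intro t
      induction t with
      | zero => simp only [map_zero, LinearMap.zero_apply]
      | add s t hs ht => simp only [map_add, LinearMap.add_apply, hs, ht]
      | tmul f g =>
        rw [hN, map_mul, map_mul, Module.End.mul_apply, hθΦD, hθΦX, mul_smul_comm, mul_one]
        simp
    refine (TensorProduct.rid ℂ (Pol E)).map_eq_zero_iff.1 ?_
    rw [← key, ht, map_zero, LinearMap.zero_apply]
  have hiter : ∀ (l : Module.Dual ℂ E) (k : ℕ) t, θ (N t) = 0 →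
      θ (N (((Pol.partialDeriv l) ^ k).lTensor (Pol E) t)) = 0 := by
    intro l k
    induction k with
    | zero => intro t ht; rwa [pow_zero, Module.End.one_eq_id, LinearMap.lTensor_id]
    | succ k ih =>
      intro t ht
      rw [pow_succ, Module.End.mul_eq_comp, LinearMap.lTensor_comp]
      refine ih _ ?_
      rw [hder, map_sub, map_mul, map_mul, ht, zero_mul, mul_zero, sub_zero]
  -- All Taylor coefficients at `0` in the second variable vanish.
  have ht : t = 0 := by
    refine TensorProduct.eq_zero_of_forall_lTensor (N := fun _ : Module.Dual ℂ E × ℕ => ℂ)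
      (fun i => ((LinearMap.proj 0 : (Module.Dual ℂ E → ℂ) →ₗ[ℂ] ℂ) ∘ₗ
        (Pol.toFun (E := Module.Dual ℂ E)).toLinearMap) ∘ₗ (Pol.partialDeriv i.1) ^ i.2)
      (fun g hg => Pol.eq_zero_of_iterate_partialDeriv fun l k => ?_) fun i => ?_
    · rw [← Module.End.coe_pow]
      exact hg (l, k)
    · rw [LinearMap.lTensor_comp]
      exact hker _ (hiter i.1 i.2 t h0)
  rw [ht, map_zero]

end IsWeylPair

/-! ## The algebraic Fourier transform -/

section Fourier

variable {E' : Type*} [AddCommGroup E'] [Module ℂ E']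

theorem IsAlgFourier.unique {b : E →ₗ[ℂ] E' →ₗ[ℂ] ℂ} (hb : Function.Surjective b.flip)
    {Φ Ψ : Weyl E ≃ₐ[ℂ] Weyl E'} (hΦ : IsAlgFourier b Φ) (hΨ : IsAlgFourier b Ψ) : Φ = Ψ := by
  have h : (Φ : Weyl E →ₐ[ℂ] Weyl E') = Ψ := Weyl.algHom_ext
    (fun l => by obtain ⟨w, rfl⟩ := hb l; exact (hΦ.2 w).trans (hΨ.2 w).symm)
    fun v => (hΦ.1 v).trans (hΨ.1 v).symm
  exact AlgEquiv.ext fun T => congrArg (fun φ : Weyl E →ₐ[ℂ] Weyl E' => φ T) h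

/-- The transform is built as a graph: the subalgebra `L` of the product generated by the prescribed
pairs. It is generated by a Weyl pair over `E` and also by one over `E'`, so both projections are
injective on it, and they hit all generators. -/
theorem existsUnique_isAlgFourier [FiniteDimensional ℂ E] [FiniteDimensional ℂ E']
    (b : E →ₗ[ℂ] E' →ₗ[ℂ] ℂ) (hb : b.IsPerfPair) :
    ∃! Φ : Weyl E ≃ₐ[ℂ] Weyl E', IsAlgFourier b Φ := by
  let e : E ≃ₗ[ℂ] Module.Dual ℂ E' := b.toPerfPair
  let e' : E' ≃ₗ[ℂ] Module.Dual ℂ E := b.flip.toPerfPair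
  have he : ∀ v, e v = b v := fun v => rfl
  have he' : ∀ w, e' w = b.flip w := fun w => rfl
  let X : Module.Dual ℂ E →ₗ[ℂ] Weyl E × Weyl E' :=
    Weyl.mulₗ.prod (Weyl.partialDerivₗ ∘ₗ e'.symm.toLinearMap)
  let D : E →ₗ[ℂ] Weyl E × Weyl E' := Weyl.partialDerivₗ.prod (-(Weyl.mulₗ ∘ₗ e.toLinearMap))
  have hXe : ∀ w, X (b.flip w) = (Weyl.mul (b.flip w), Weyl.partialDeriv w) := fun w => by
    change (_, Weyl.partialDeriv (e'.symm (b.flip w))) = _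
    rw [← he', e'.symm_apply_apply]
    rfl
  have hDe : ∀ v, D v = (Weyl.partialDeriv v, -Weyl.mul (b v)) := fun v => rfl
  have hsurj : ∀ l, ∃ w, l = b.flip w := fun l => ⟨e'.symm l, (e'.apply_symm_apply l).symm⟩
  have h : IsWeylPair X D :=
    { commute_left := fun l l' =>
        (Weyl.commute_mul l l').prod (Weyl.commute_partialDeriv _ _)
      commute_right := fun v w => (Weyl.commute_partialDeriv v w).prod
        ((Weyl.commute_mul _ _).neg_left.neg_right)
      comm := fun v l => by
        obtain ⟨w, rfl⟩ := hsurj l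
        rw [hXe, hDe]
        refine Prod.ext (Weyl.partialDeriv_mul_mul v _) ?_
        change -Weyl.mul (b v) * Weyl.partialDeriv w =
          Weyl.partialDeriv w * -Weyl.mul (b v) + algebraMap ℂ (Weyl E') (b v w)
        rw [mul_neg, Weyl.partialDeriv_mul_mul]
        noncomm_ring }
  -- The same generators seen from `E'`: multiplications and derivatives trade places, with a sign
  -- that preserves the commutation relations.
  let X' : Module.Dual ℂ E' →ₗ[ℂ] Weyl E × Weyl E' := -(D ∘ₗ e.symm.toLinearMap)
  let D' : E' →ₗ[ℂ] Weyl E × Weyl E' := X ∘ₗ e'.toLinearMap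
  have hX' : ∀ v, X' (b v) = -D v := fun v => by
    change -D (e.symm (b v)) = _
    rw [← he, e.symm_apply_apply]
  have hsurj' : ∀ l, ∃ v, l = b v := fun l => ⟨e.symm l, (e.apply_symm_apply l).symm⟩
  have h' : IsWeylPair X' D' :=
    { commute_left := fun l l' => (h.commute_right _ _).neg_left.neg_right
      commute_right := fun v w => h.commute_left _ _
      comm := fun w l => by
        obtain ⟨v, rfl⟩ := hsurj' l
        rw [hX']
        change X (b.flip w) * -D v = -D v * X (b.flip w) + algebraMap ℂ _ (b.flip w v)
        rw [neg_mul, h.comm]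
        noncomm_ring }
  let L := Algebra.adjoin ℂ (Set.range X ∪ Set.range D)
  have hL : L ≤ Algebra.adjoin ℂ (Set.range X' ∪ Set.range D') := by
    refine Algebra.adjoin_le ?_
    rintro _ (⟨l, rfl⟩ | ⟨v, rfl⟩)
    · obtain ⟨w, rfl⟩ := hsurj l
      exact Algebra.subset_adjoin (Or.inr ⟨w, rfl⟩)
    · have h1 : D v = -X' (b v) := by rw [hX', neg_neg]
      rw [h1]
      exact Subalgebra.neg_mem _ (Algebra.subset_adjoin (Or.inl ⟨b v, rfl⟩))
  have hXL : ∀ l, X l ∈ L := fun l => Algebra.subset_adjoin (Or.inl ⟨l, rfl⟩)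
  have hDL : ∀ v, D v ∈ L := fun v => Algebra.subset_adjoin (Or.inr ⟨v, rfl⟩)
  let p₁ : L →ₐ[ℂ] Weyl E := (AlgHom.fst ℂ (Weyl E) (Weyl E')).comp L.val
  let p₂ : L →ₐ[ℂ] Weyl E' := (AlgHom.snd ℂ (Weyl E) (Weyl E')).comp L.val
  have hp₁ : Function.Bijective p₁ := by
    constructor
    · rw [injective_iff_map_eq_zero]
      intro a ha
      exact Subtype.ext (h.eq_zero_of_mem_adjoin (θ := AlgHom.fst ℂ (Weyl E) (Weyl E'))
        (fun l => rfl) (fun v => rfl) a.2 ha)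
    · intro T
      change T ∈ p₁.range
      induction T using Weyl.induction with
      | mul_lin l => exact ⟨⟨X l, hXL l⟩, rfl⟩
      | partialDeriv v => exact ⟨⟨D v, hDL v⟩, rfl⟩
      | algebraMap c => exact Subalgebra.algebraMap_mem _ c
      | add S T hS hT => exact Subalgebra.add_mem _ hS hT
      | mul S T hS hT => exact Subalgebra.mul_mem _ hS hT
  have hp₂ : Function.Bijective p₂ := by
    constructor
    · rw [injective_iff_map_eq_zero]
      intro a ha
      refine Subtype.ext (h'.eq_zero_of_mem_adjoin (θ := AlgHom.snd ℂ (Weyl E) (Weyl E'))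
        (fun l => ?_) (fun w => ?_) (hL a.2) ha)
      · obtain ⟨v, rfl⟩ := hsurj' l
        rw [hX', hDe]
        exact neg_neg _
      · change (X (b.flip w)).2 = _
        rw [hXe]
    · intro T
      change T ∈ p₂.range
      induction T using Weyl.induction with
      | mul_lin l =>
        obtain ⟨v, rfl⟩ := hsurj' l
        have h1 : -Weyl.mul (b v) ∈ p₂.range := ⟨⟨D v, hDL v⟩, rfl⟩
        simpa using Subalgebra.neg_mem _ h1
      | partialDeriv w =>
        refine ⟨⟨X (b.flip w), hXL _⟩, ?_⟩
        change (X (b.flip w)).2 = _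
        rw [hXe]
      | algebraMap c => exact Subalgebra.algebraMap_mem _ c
      | add S T hS hT => exact Subalgebra.add_mem _ hS hT
      | mul S T hS hT => exact Subalgebra.mul_mem _ hS hT
  let e₁ := AlgEquiv.ofBijective p₁ hp₁
  let e₂ := AlgEquiv.ofBijective p₂ hp₂
  have hΦ : IsAlgFourier b (e₁.symm.trans e₂) := by
    refine ⟨fun v => ?_, fun w => ?_⟩
    · have h1 : e₁.symm (Weyl.partialDeriv v) = ⟨D v, hDL v⟩ := by
        rw [AlgEquiv.symm_apply_eq]; rfl
      rw [AlgEquiv.trans_apply, h1]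
      rfl
    · have h1 : e₁.symm (Weyl.mul (b.flip w)) = ⟨X (b.flip w), hXL _⟩ := by
        rw [AlgEquiv.symm_apply_eq]; rfl
      rw [AlgEquiv.trans_apply, h1]
      change (X (b.flip w)).2 = _
      rw [hXe]
  exact ⟨_, hΦ, fun Ψ hΨ => hΨ.unique e'.surjective hΦ⟩

end Fourier

end WeylAlgebra

/-! ## First order differential operators -/

section FirstOrder

variable {E : Type*} [AddCommGroup E] [Module ℂ E]
variable {U W : Type*} [AddCommGroup U] [Module ℂ U] [AddCommGroup W] [Module ℂ W]

namespace Weyl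

variable (E) in
/-- The multiplications by polynomial functions, in the Weyl algebra. -/
def pol : Pol E →ₐ[ℂ] Weyl E :=
  (Algebra.lmul ℂ (Pol E)).codRestrict (weylSubalgebra E) fun f => by
    induction f using Pol.induction with
    | lin l => exact Algebra.subset_adjoin (Or.inl ⟨l, rfl⟩)
    | algebraMap c => rw [AlgHom.commutes]; exact Subalgebra.algebraMap_mem _ c
    | add f g hf hg => rw [map_add]; exact Subalgebra.add_mem _ hf hg
    | mul f g hf hg => rw [map_mul]; exact Subalgebra.mul_mem _ hf hg

@[simp]
theorem toEnd_pol (f g : Pol E) : Weyl.toEnd (pol E f) g = f * g := rfl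

theorem pol_lin (l : Module.Dual ℂ E) : pol E (Pol.lin l) = Weyl.mul l := rfl

theorem partialDeriv_mul_pol (v : E) (f : Pol E) :
    Weyl.partialDeriv v * pol E f = pol E f * Weyl.partialDeriv v +
      pol E (Pol.partialDeriv v f) := by
  refine ext_toEnd fun g => ?_
  simp only [map_add, map_mul, Module.End.mul_apply, LinearMap.add_apply, toEnd_partialDeriv,
    toEnd_pol, Pol.partialDeriv_mul]
  ring

/-- The multiplication by the `End(W)`-valued polynomial function `μ ∘ a`. -/
def mulOp (μ : U →ₗ[ℂ] Module.End ℂ W) : Pol E ⊗[ℂ] U →ₗ[ℂ] Weyl E ⊗[ℂ] Module.End ℂ W :=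
  TensorProduct.map (pol E).toLinearMap μ

/-- A polynomial vector field, in the Weyl algebra. -/
def vecOp : Pol E ⊗[ℂ] E →ₗ[ℂ] Weyl E :=
  TensorProduct.lift ((LinearMap.mul ℂ (Weyl E)).compl₁₂ (pol E).toLinearMap partialDerivₗ)

theorem mulOp_tmul (μ : U →ₗ[ℂ] Module.End ℂ W) (f : Pol E) (a : U) :
    mulOp μ (f ⊗ₜ[ℂ] a) = pol E f ⊗ₜ[ℂ] μ a := rfl

theorem vecOp_tmul (f : Pol E) (v : E) :
    vecOp (f ⊗ₜ[ℂ] v) = pol E f * Weyl.partialDeriv v := rfl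

variable (W) in
/-- The operator `μ ∘ a - x` for a polynomial function `a` and a polynomial vector field `x`. -/
def op (μ : U →ₗ[ℂ] Module.End ℂ W) (a : Pol E ⊗[ℂ] U) (x : Pol E ⊗[ℂ] E) :
    Weyl E ⊗[ℂ] Module.End ℂ W :=
  mulOp μ a - vecOp x ⊗ₜ[ℂ] 1

/-- The derivative of a vector-valued polynomial function at a point, linear in the direction. -/
def derivAt (F : Pol E ⊗[ℂ] W) (x : E) : E →ₗ[ℂ] W where
  toFun v := Pol.evalAt x (Weyl.act E W (Weyl.partialDeriv v ⊗ₜ[ℂ] 1) F)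
  map_add' v w := by
    rw [← partialDerivₗ_apply, map_add, TensorProduct.add_tmul, map_add, LinearMap.add_apply,
      map_add]
    rfl
  map_smul' c v := by
    rw [← partialDerivₗ_apply, map_smul, ← TensorProduct.smul_tmul', map_smul, LinearMap.smul_apply,
      map_smul]
    rfl

theorem derivAt_apply (F : Pol E ⊗[ℂ] W) (x v : E) :
    derivAt F x v = Pol.evalAt x (Weyl.act E W (Weyl.partialDeriv v ⊗ₜ[ℂ] 1) F) := rfl

theorem derivAt_comm (F : Pol E ⊗[ℂ] W) (x v w : E) :
    derivAt (Weyl.act E W (Weyl.partialDeriv v ⊗ₜ[ℂ] 1) F) x w =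
      derivAt (Weyl.act E W (Weyl.partialDeriv w ⊗ₜ[ℂ] 1) F) x v := by
  rw [derivAt_apply, derivAt_apply, ← Module.End.mul_apply, ← Module.End.mul_apply, ← map_mul,
    ← map_mul, Algebra.TensorProduct.tmul_mul_tmul, Algebra.TensorProduct.tmul_mul_tmul,
    (commute_partialDeriv w v).eq]

theorem evalAt_act_mulOp (μ : U →ₗ[ℂ] Module.End ℂ W) (a : Pol E ⊗[ℂ] U) (F : Pol E ⊗[ℂ] W)
    (x : E) : Pol.evalAt x (Weyl.act E W (mulOp μ a) F) =
      μ (Pol.evalAt x a) (Pol.evalAt x F) := by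
  induction a with
  | zero => simp only [map_zero, LinearMap.zero_apply]
  | add a b ha hb => simp only [map_add, LinearMap.add_apply, ha, hb]
  | tmul f a =>
    induction F with
    | zero => simp only [map_zero]
    | add F G hF hG => simp only [map_add, hF, hG]
    | tmul g w =>
      rw [mulOp_tmul, act_tmul_tmul, toEnd_pol, Pol.evalAt_tmul, Pol.evalAt_tmul, Pol.evalAt_tmul,
        map_mul, Pi.mul_apply, map_smul μ, LinearMap.smul_apply, map_smul (μ a), smul_smul]

theorem evalAt_act_vecOp (x : Pol E ⊗[ℂ] E) (F : Pol E ⊗[ℂ] W) (p : E) :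
    Pol.evalAt p (Weyl.act E W (vecOp x ⊗ₜ[ℂ] 1) F) = derivAt F p (Pol.evalAt p x) := by
  induction x with
  | zero => simp only [map_zero, TensorProduct.zero_tmul, LinearMap.zero_apply]
  | add x y hx hy => simp only [map_add, TensorProduct.add_tmul, LinearMap.add_apply, hx, hy]
  | tmul f v =>
    rw [Pol.evalAt_tmul, map_smul, derivAt_apply, vecOp_tmul]
    induction F with
    | zero => simp only [map_zero, smul_zero]
    | add F G hF hG => simp only [map_add, smul_add, hF, hG]
    | tmul g w =>
      rw [act_tmul_tmul, act_tmul_tmul, map_mul, Module.End.mul_apply, toEnd_pol, Pol.evalAt_tmul,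
        Pol.evalAt_tmul, map_mul, Pi.mul_apply, smul_smul]

theorem evalAt_act_op (μ : U →ₗ[ℂ] Module.End ℂ W) (a : Pol E ⊗[ℂ] U) (x : Pol E ⊗[ℂ] E)
    (F : Pol E ⊗[ℂ] W) (p : E) : Pol.evalAt p (Weyl.act E W (op W μ a x) F) =
      μ (Pol.evalAt p a) (Pol.evalAt p F) - derivAt F p (Pol.evalAt p x) := by
  rw [op, map_sub, LinearMap.sub_apply, map_sub, evalAt_act_mulOp, evalAt_act_vecOp]

/-- Commuting with a constant vector field differentiates the coefficients. -/
theorem partialDeriv_mul_op (μ : U →ₗ[ℂ] Module.End ℂ W) (a : Pol E ⊗[ℂ] U) (x : Pol E ⊗[ℂ] E)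
    (v : E) : Weyl.partialDeriv v ⊗ₜ[ℂ] 1 * op W μ a x = op W μ a x * Weyl.partialDeriv v ⊗ₜ[ℂ] 1 +
      op W μ ((Pol.partialDeriv v).rTensor U a) ((Pol.partialDeriv v).rTensor E x) := by
  have h1 : Weyl.partialDeriv v ⊗ₜ[ℂ] (1 : Module.End ℂ W) * mulOp μ a =
      mulOp μ a * Weyl.partialDeriv v ⊗ₜ[ℂ] 1 + mulOp μ ((Pol.partialDeriv v).rTensor U a) := by
    induction a with
    | zero => simp only [map_zero, mul_zero, zero_mul, add_zero]
    | add a b ha hb => simp only [map_add, mul_add, add_mul, ha, hb]; abel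
    | tmul f a =>
      rw [LinearMap.rTensor_tmul, mulOp_tmul, mulOp_tmul, Algebra.TensorProduct.tmul_mul_tmul,
        Algebra.TensorProduct.tmul_mul_tmul, partialDeriv_mul_pol, TensorProduct.add_tmul, one_mul,
        mul_one]
  have h2 : Weyl.partialDeriv v * vecOp x =
      vecOp x * Weyl.partialDeriv v + vecOp ((Pol.partialDeriv v).rTensor E x) := by
    induction x with
    | zero => simp only [map_zero, mul_zero, zero_mul, add_zero]
    | add a b ha hb => simp only [map_add, mul_add, add_mul, ha, hb]; abel
    | tmul f w =>
      rw [LinearMap.rTensor_tmul, vecOp_tmul, vecOp_tmul, ← mul_assoc, partialDeriv_mul_pol, add_mul,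
        mul_assoc, (commute_partialDeriv v w).eq, mul_assoc]
  rw [op, op, mul_sub, sub_mul, h1, Algebra.TensorProduct.tmul_mul_tmul,
    Algebra.TensorProduct.tmul_mul_tmul, h2, TensorProduct.add_tmul, one_mul]
  abel

theorem derivAt_act_op (μ : U →ₗ[ℂ] Module.End ℂ W) (a : Pol E ⊗[ℂ] U) (x : Pol E ⊗[ℂ] E)
    (F : Pol E ⊗[ℂ] W) (p v : E) : derivAt (Weyl.act E W (op W μ a x) F) p v =
      μ (Pol.evalAt p a) (derivAt F p v) -
        derivAt (Weyl.act E W (Weyl.partialDeriv v ⊗ₜ[ℂ] 1) F) p (Pol.evalAt p x) +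
      (μ (Pol.evalAt p ((Pol.partialDeriv v).rTensor U a)) (Pol.evalAt p F) -
        derivAt F p (Pol.evalAt p ((Pol.partialDeriv v).rTensor E x))) := by
  rw [derivAt_apply, ← Module.End.mul_apply, ← map_mul, partialDeriv_mul_op, map_add, map_mul,
    LinearMap.add_apply, map_add, Module.End.mul_apply, evalAt_act_op, evalAt_act_op,
    ← derivAt_apply]

theorem _root_.Pol.rTensor_lTensor (φ : U →ₗ[ℂ] W) (v : E) (t : Pol E ⊗[ℂ] U) :
    (Pol.partialDeriv v).rTensor W (φ.lTensor _ t) =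
      φ.lTensor _ ((Pol.partialDeriv v).rTensor U t) := by
  rw [← LinearMap.comp_apply, ← LinearMap.comp_apply, LinearMap.rTensor_comp_lTensor,
    LinearMap.lTensor_comp_rTensor]

/-- The commutator of two first order operators is again of first order. Its zeroth order part is
the commutator of the potentials corrected by their derivatives along the fields; the sign in the
condition on `z` comes from the minus sign in front of the vector field in `op`. -/
theorem op_eq_commutator {μ : U →ₗ[ℂ] Module.End ℂ W} {a b c : Pol E ⊗[ℂ] U} {x y z : Pol E ⊗[ℂ] E}
    (hc : ∀ p, μ (Pol.evalAt p c) =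
      μ (Pol.evalAt p a) * μ (Pol.evalAt p b) - μ (Pol.evalAt p b) * μ (Pol.evalAt p a) -
        μ (Pol.evalAt p ((Pol.partialDeriv (Pol.evalAt p x)).rTensor U b)) +
        μ (Pol.evalAt p ((Pol.partialDeriv (Pol.evalAt p y)).rTensor U a)))
    (hz : ∀ p, Pol.evalAt p z =
      Pol.evalAt p ((Pol.partialDeriv (Pol.evalAt p y)).rTensor E x) -
        Pol.evalAt p ((Pol.partialDeriv (Pol.evalAt p x)).rTensor E y)) :
    op W μ c z = op W μ a x * op W μ b y - op W μ b y * op W μ a x := by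
  refine ext_act fun F p => ?_
  simp only [map_sub, map_mul, LinearMap.sub_apply, Module.End.mul_apply, evalAt_act_op,
    derivAt_act_op, hc, hz, LinearMap.add_apply]
  -- Symmetry of second derivatives cancels the second order terms.
  rw [derivAt_comm F p (Pol.evalAt p x)]
  abel

end Weyl

end FirstOrder

/-! ## The infinitesimal principal series action -/

section PrincipalSeries

variable {𝔤 : Type*} [LieRing 𝔤] [LieAlgebra ℂ 𝔤]

section MuRep

variable {H : 𝔤} (V : Type*) [AddCommGroup V] [Module ℂ V] [LieRingModule (levi H) V]
  [LieModule ℂ (levi H) V]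

/-- The representation `μ` as a linear map. -/
def muRepₗ : levi H →ₗ[ℂ] Module.End ℂ (Module.Dual ℂ V) where
  toFun := muRep V
  map_add' a b := by
    have h : adNPlus (a + b) = adNPlus a + adNPlus b := by
      ext x
      exact add_lie (a : 𝔤) (b : 𝔤) (x : 𝔤)
    rw [muRep, muRep, muRep, h, map_add, map_add, add_smul]
    abel
  map_smul' c a := by
    have h : adNPlus (c • a) = c • adNPlus a := by
      ext x
      exact smul_lie c (a : 𝔤) (x : 𝔤)
    rw [muRep, muRep, h, map_smul, map_smul, smul_eq_mul, mul_smul, RingHom.id_apply, smul_add]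

@[simp] theorem muRepₗ_apply (a : levi H) : muRepₗ V a = muRep V a := rfl

/-- The added scalars commute with everything, and the trace vanishes on commutators. -/
theorem muRep_lie (a b : levi H) :
    muRep V ⁅a, b⁆ = muRep V a * muRep V b - muRep V b * muRep V a := by
  have h : adNPlus ⁅a, b⁆ = adNPlus a * adNPlus b - adNPlus b * adNPlus a := by
    ext x
    exact lie_lie (a : 𝔤) (b : 𝔤) (x : 𝔤)
  rw [muRep, muRep, muRep, h, map_sub, LinearMap.trace_mul_comm, sub_self, zero_smul, add_zero,
    LieHom.map_lie, Ring.lie_def]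
  simp only [mul_add, add_mul, smul_mul_assoc, mul_smul_comm, one_mul, mul_one, smul_add]
  rw [smul_comm (LinearMap.trace ℂ (nPlus H) (adNPlus b))]
  abel

variable {V} in
theorem IsPrincipalSeriesAction.unique {hH : IsHyperbolic H}
    {dπ dπ' : 𝔤 →ₗ⁅ℂ⁆ Weyl (nMinus H) ⊗[ℂ] Module.End ℂ (Module.Dual ℂ V)}
    (h : IsPrincipalSeriesAction hH V dπ) (h' : IsPrincipalSeriesAction hH V dπ') : dπ = dπ' := by
  refine LieHom.ext fun Y => Weyl.ext_act fun F X => ?_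
  rw [h, h']

end MuRep

namespace HasAbelianNilradicals

variable {B : LinearMap.BilinForm ℂ 𝔤} {H : 𝔤}

/-- The defect of the projection as a homomorphism comes only from the `𝔫₋`-components bracketed
with `𝔫₊`. This and `projMinus_lie` are the infinitesimal cocycle identities that turn into the
hypotheses of `Weyl.op_eq_commutator`. -/
theorem projLevi_lie (h : HasAbelianNilradicals B H) (y z : 𝔤) :
    projLevi h.hyp ⁅y, z⁆ = ⁅projLevi h.hyp y, projLevi h.hyp z⁆ +
      projLevi h.hyp ⁅(projMinus h.hyp y : 𝔤), z⁆ - projLevi h.hyp ⁅(projMinus h.hyp z : 𝔤), y⁆ := by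
  obtain ⟨u, a, v, rfl⟩ := exists_triangular_decomposition h.hyp y
  obtain ⟨u', a', v', rfl⟩ := exists_triangular_decomposition h.hyp z
  have e1 : ∀ (u : nMinus H) (a : levi H), projLevi h.hyp ⁅(u : 𝔤), (a : 𝔤)⁆ = 0 := fun u a =>
    projLevi_nMinus h.hyp ⟨_, lie_nMinus_levi_mem u a⟩
  have e2 : ∀ (v : nPlus H) (a : levi H), projLevi h.hyp ⁅(a : 𝔤), (v : 𝔤)⁆ = 0 := fun v a =>
    projLevi_nPlus h.hyp (adNPlus a v)
  have e3 : projLevi h.hyp ⁅(a : 𝔤), (a' : 𝔤)⁆ = ⁅a, a'⁆ := projLevi_of_mem h.hyp ⁅a, a'⁆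
  have e4 : ∀ x y : 𝔤, projLevi h.hyp ⁅x, y⁆ = -projLevi h.hyp ⁅y, x⁆ := fun x y => by
    rw [← lie_skew, map_neg]
  simp only [map_add, projLevi_nMinus, projLevi_nPlus, projLevi_of_mem, projMinus_coe,
    projMinus_levi, projMinus_nPlus, zero_add, add_zero, lie_add, add_lie, e1, e2, e3,
    h.minus u u.2 u' u'.2, h.minus u' u'.2 u u.2, h.plus v v.2 v' v'.2, e4 (a : 𝔤) u',
    e4 (v : 𝔤) a', e4 (v : 𝔤) u', neg_zero]
  abel

theorem projMinus_lie (h : HasAbelianNilradicals B H) (y z : 𝔤) :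
    projMinus h.hyp ⁅y, z⁆ =
      projMinus h.hyp ⁅(projMinus h.hyp y : 𝔤), z⁆ -
        projMinus h.hyp ⁅(projMinus h.hyp z : 𝔤), y⁆ := by
  obtain ⟨u, a, v, rfl⟩ := exists_triangular_decomposition h.hyp y
  obtain ⟨u', a', v', rfl⟩ := exists_triangular_decomposition h.hyp z
  have e2 : ∀ (v : nPlus H) (a : levi H), projMinus h.hyp ⁅(a : 𝔤), (v : 𝔤)⁆ = 0 := fun v a =>
    projMinus_nPlus h.hyp (adNPlus a v)
  have e3 : projMinus h.hyp ⁅(a : 𝔤), (a' : 𝔤)⁆ = 0 := projMinus_levi h.hyp ⁅a, a'⁆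
  have e4 : ∀ x y : 𝔤, projMinus h.hyp ⁅x, y⁆ = -projMinus h.hyp ⁅y, x⁆ := fun x y => by
    rw [← lie_skew, map_neg]
  have e5 : ∀ (u : nMinus H) (v : nPlus H), projMinus h.hyp ⁅(u : 𝔤), (v : 𝔤)⁆ = 0 := fun u v =>
    projMinus_levi h.hyp ⟨_, h.lie_nMinus_nPlus_mem u v⟩
  simp only [map_add, projMinus_coe,
    projMinus_levi, projMinus_nPlus, zero_add, add_zero, lie_add, add_lie, e2, e3, e5,
    h.minus u u.2 u' u'.2, h.minus u' u'.2 u u.2, h.plus v v.2 v' v'.2, e4 (a : 𝔤) u',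
    e4 (v : 𝔤) a', e4 (v : 𝔤) u', neg_zero]
  abel

end HasAbelianNilradicals

/-- The polynomial function `X ↦ Ad(e^{-X}) Y` on `𝔫₋`. -/
def adExpNegPol (H : 𝔤) [FiniteDimensional ℂ 𝔤] : 𝔤 →ₗ[ℂ] Pol (nMinus H) ⊗[ℂ] 𝔤 :=
  let e := Module.finBasis ℂ (nMinus H)
  TensorProduct.mk ℂ _ _ 1 -
    ∑ i, TensorProduct.mk ℂ _ _ (Pol.lin (e.coord i)) ∘ₗ (LieAlgebra.ad ℂ 𝔤 (e i : 𝔤)) +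
    (1 / 2 : ℂ) • ∑ i, ∑ j, TensorProduct.mk ℂ _ _ (Pol.lin (e.coord i) * Pol.lin (e.coord j)) ∘ₗ
      (LieAlgebra.ad ℂ 𝔤 (e i : 𝔤) ∘ₗ LieAlgebra.ad ℂ 𝔤 (e j : 𝔤))

variable [FiniteDimensional ℂ 𝔤]

theorem adExpNegPol_apply (H Y : 𝔤) : adExpNegPol H Y =
    1 ⊗ₜ[ℂ] Y - ∑ i, Pol.lin ((Module.finBasis ℂ (nMinus H)).coord i) ⊗ₜ[ℂ]
        ⁅(Module.finBasis ℂ (nMinus H) i : 𝔤), Y⁆ +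
      (1 / 2 : ℂ) • ∑ i, ∑ j, (Pol.lin ((Module.finBasis ℂ (nMinus H)).coord i) *
        Pol.lin ((Module.finBasis ℂ (nMinus H)).coord j)) ⊗ₜ[ℂ]
        ⁅(Module.finBasis ℂ (nMinus H) i : 𝔤), ⁅(Module.finBasis ℂ (nMinus H) j : 𝔤), Y⁆⁆ := by
  simp [adExpNegPol]

theorem sum_coord_smul_lie {H : 𝔤} (X : nMinus H) (Y : 𝔤) :
    ∑ i, (Module.finBasis ℂ (nMinus H)).coord i X • ⁅(Module.finBasis ℂ (nMinus H) i : 𝔤), Y⁆ =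
      ⁅(X : 𝔤), Y⁆ := by
  have h := congrArg (fun x : nMinus H => ⁅(x : 𝔤), Y⁆) ((Module.finBasis ℂ (nMinus H)).sum_repr X)
  rw [← h]
  have h2 : ∀ s : Finset (Fin (Module.finrank ℂ (nMinus H))), ∀ f : _ → nMinus H,
      ((∑ i ∈ s, f i : nMinus H) : 𝔤) = ∑ i ∈ s, (f i : 𝔤) := fun s f =>
    map_sum (nMinus H).incl f s
  rw [h2, sum_lie]
  refine Finset.sum_congr rfl fun i _ => ?_
  exact (smul_lie _ _ _).symm

theorem sum_sum_coord_smul_lie {H : 𝔤} (X X' : nMinus H) (Y : 𝔤) :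
    ∑ i, ∑ j, ((Module.finBasis ℂ (nMinus H)).coord i X * (Module.finBasis ℂ (nMinus H)).coord j X') •
      ⁅(Module.finBasis ℂ (nMinus H) i : 𝔤), ⁅(Module.finBasis ℂ (nMinus H) j : 𝔤), Y⁆⁆ =
      ⁅(X : 𝔤), ⁅(X' : 𝔤), Y⁆⁆ := by
  rw [← sum_coord_smul_lie X]
  refine Finset.sum_congr rfl fun i _ => ?_
  rw [← sum_coord_smul_lie X', lie_sum, Finset.smul_sum]
  refine Finset.sum_congr rfl fun j _ => ?_
  rw [lie_smul, smul_smul]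

namespace HasAbelianNilradicals

variable {B : LinearMap.BilinForm ℂ 𝔤} {H : 𝔤}

theorem evalAt_adExpNegPol (h : HasAbelianNilradicals B H) (X : nMinus H) (Y : 𝔤) :
    Pol.evalAt X (adExpNegPol H Y) = AdExpNeg (X : 𝔤) Y := by
  rw [adExpNegPol_apply, h.AdExpNeg_eq, ← sum_sum_coord_smul_lie, ← sum_coord_smul_lie]
  simp only [map_add, map_sub, map_sum, map_smul, Pol.evalAt_tmul, map_mul, Pi.mul_apply,
    Pol.toFun_lin, map_one, Pi.one_apply, one_smul]

/-- As `ad v` and `ad X` commute, differentiating the exponential brings down `-ad v`; the missing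
quadratic term is zero by `lie_nMinus_cube`. -/
theorem evalAt_partialDeriv_adExpNegPol (h : HasAbelianNilradicals B H) (X v : nMinus H) (Y : 𝔤) :
    Pol.evalAt X ((Pol.partialDeriv v).rTensor 𝔤 (adExpNegPol H Y)) =
      -⁅(v : 𝔤), AdExpNeg (X : 𝔤) Y⁆ := by
  have h1 : Pol.evalAt X ((Pol.partialDeriv v).rTensor 𝔤 (adExpNegPol H Y)) =
      -⁅(v : 𝔤), Y⁆ + (1 / 2 : ℂ) • (⁅(v : 𝔤), ⁅(X : 𝔤), Y⁆⁆ + ⁅(X : 𝔤), ⁅(v : 𝔤), Y⁆⁆) := by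
    rw [adExpNegPol_apply, ← sum_sum_coord_smul_lie v X, ← sum_sum_coord_smul_lie X v,
      ← sum_coord_smul_lie v, ← Finset.sum_add_distrib]
    simp only [map_add, map_sub, map_sum, map_smul, LinearMap.rTensor_tmul, Pol.partialDeriv_one,
      Pol.partialDeriv_mul, Pol.partialDeriv_lin, TensorProduct.zero_tmul, zero_sub, map_neg,
      Pol.evalAt_tmul, map_mul, Pi.mul_apply, Pi.add_apply, Pol.toFun_lin, AlgHom.commutes,
      Pi.algebraMap_apply, Algebra.algebraMap_self, RingHom.id_apply, add_smul,
      Finset.sum_add_distrib]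
  have h2 : ⁅(X : 𝔤), ⁅(v : 𝔤), Y⁆⁆ = ⁅(v : 𝔤), ⁅(X : 𝔤), Y⁆⁆ := by
    rw [leibniz_lie, h.minus X X.2 v v.2, zero_lie, zero_add]
  rw [h1, h2, h.AdExpNeg_eq, lie_add, lie_sub, lie_smul, h.lie_nMinus_cube]
  module

variable (V : Type*) [AddCommGroup V] [Module ℂ V] [LieRingModule (levi H) V]
  [LieModule ℂ (levi H) V]

/-- The infinitesimal principal series action `dπ_μ`. -/
def principalSeries (h : HasAbelianNilradicals B H) :
    𝔤 →ₗ⁅ℂ⁆ Weyl (nMinus H) ⊗[ℂ] Module.End ℂ (Module.Dual ℂ V) where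
  toFun Y := Weyl.op _ (muRepₗ V) ((projLevi h.hyp).lTensor _ (adExpNegPol H Y))
    ((projMinus h.hyp).lTensor _ (adExpNegPol H Y))
  map_add' Y Z := by
    simp only [Weyl.op, map_add, TensorProduct.add_tmul]
    abel
  map_smul' c Y := by
    simp only [Weyl.op, map_smul, ← TensorProduct.smul_tmul', smul_sub, RingHom.id_apply]
  map_lie' {Y Z} := by
    rw [Ring.lie_def]
    -- At the point `p`, both conditions are the projection identities for `e^{-ad p} Y` and `e^{-ad
    -- p} Z`, with each derivative replaced by minus a bracket.
    refine Weyl.op_eq_commutator (fun p => ?_) fun p => ?_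
    · simp only [Pol.rTensor_lTensor, Pol.evalAt_lTensor, h.evalAt_adExpNegPol,
        h.evalAt_partialDeriv_adExpNegPol, muRepₗ_apply]
      rw [← muRep_lie, h.AdExpNeg_lie, h.projLevi_lie]
      simp only [← muRepₗ_apply, map_add, map_sub, map_neg]
      abel
    · simp only [Pol.rTensor_lTensor, Pol.evalAt_lTensor, h.evalAt_adExpNegPol,
        h.evalAt_partialDeriv_adExpNegPol]
      rw [h.AdExpNeg_lie, h.projMinus_lie]
      simp only [map_neg]
      abel

theorem principalSeries_apply (h : HasAbelianNilradicals B H) (Y : 𝔤) : h.principalSeries V Y =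
    Weyl.op _ (muRepₗ V) ((projLevi h.hyp).lTensor _ (adExpNegPol H Y))
      ((projMinus h.hyp).lTensor _ (adExpNegPol H Y)) := rfl

theorem isPrincipalSeriesAction_principalSeries (h : HasAbelianNilradicals B H) :
    IsPrincipalSeriesAction h.hyp V (h.principalSeries V) := by
  intro Y F X
  rw [principalSeries_apply, Weyl.evalAt_act_op, Pol.evalAt_lTensor, Pol.evalAt_lTensor,
    h.evalAt_adExpNegPol]
  rfl

end HasAbelianNilradicals

end PrincipalSeries

/-! ## Frobenius reciprocity and generators of induced modules -/

section InducedModules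

open UniversalEnvelopingAlgebra in
-- The elements with `p` form a subalgebra through which the universal map factors, and the
-- composite with the inclusion is the identity.
theorem UniversalEnvelopingAlgebra.induction_ι {L : Type*} [LieRing L] [LieAlgebra ℂ L]
    {p : UniversalEnvelopingAlgebra ℂ L → Prop} (hι : ∀ x, p (ι ℂ x))
    (halg : ∀ c : ℂ, p (algebraMap ℂ _ c)) (hadd : ∀ a b, p a → p b → p (a + b))
    (hmul : ∀ a b, p a → p b → p (a * b)) (a : UniversalEnvelopingAlgebra ℂ L) : p a := by
  let S : Subalgebra ℂ (UniversalEnvelopingAlgebra ℂ L) :=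
    { carrier := {a | p a}
      mul_mem' := fun {a b} ha hb => hmul a b ha hb
      add_mem' := fun {a b} ha hb => hadd a b ha hb
      algebraMap_mem' := halg }
  let φ : L →ₗ⁅ℂ⁆ S :=
    { toFun := fun x => ⟨ι ℂ x, hι x⟩
      map_add' := fun x y => Subtype.ext (map_add (ι ℂ) x y)
      map_smul' := fun c x => Subtype.ext (map_smul (ι ℂ) c x)
      map_lie' := fun {x y} => Subtype.ext (LieHom.map_lie (ι ℂ) x y) }
  have h : S.val.comp (lift ℂ φ) = AlgHom.id ℂ _ := by
    refine UniversalEnvelopingAlgebra.hom_ext (R := ℂ) (LieHom.ext fun x => ?_)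
    change ((UniversalEnvelopingAlgebra.lift ℂ φ (ι ℂ x) : S) : UniversalEnvelopingAlgebra ℂ L) = ι ℂ x
    rw [lift_ι_apply]
    rfl
  have h2 := congrArg (fun f : UniversalEnvelopingAlgebra ℂ L →ₐ[ℂ] _ => f a) h
  have h3 : ((lift ℂ φ a : S) : UniversalEnvelopingAlgebra ℂ L) = a := h2
  rw [← h3]
  exact (lift ℂ φ a : S).2

variable {𝔤 : Type*} [LieRing 𝔤] [LieAlgebra ℂ 𝔤] {W : Type*} [AddCommGroup W] [Module ℂ W]
  {𝔥 : LieSubalgebra ℂ 𝔤} {σ : 𝔥 →ₗ⁅ℂ⁆ Module.End ℂ W}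

namespace Ind

variable (𝔥 σ) in
/-- The quotient map `U(𝔤) ⊗ W → ind(W)`. -/
def mkₗ : UniversalEnvelopingAlgebra ℂ 𝔤 ⊗[ℂ] W →ₗ[ℂ] Ind 𝔥 σ :=
  (inducedRel 𝔥 σ).mkQ.restrictScalars ℂ

theorem mkₗ_tmul (u : UniversalEnvelopingAlgebra ℂ 𝔤) (w : W) :
    mkₗ 𝔥 σ (u ⊗ₜ[ℂ] w) = Ind.mk 𝔥 σ u w := rfl

theorem mkₗ_surjective : Function.Surjective (mkₗ 𝔥 σ) := (inducedRel 𝔥 σ).mkQ_surjective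

theorem smul_mk (u u' : UniversalEnvelopingAlgebra ℂ 𝔤) (w : W) :
    u • Ind.mk 𝔥 σ u' w = Ind.mk 𝔥 σ (u * u') w := rfl

theorem mk_mul_incl (u : UniversalEnvelopingAlgebra ℂ 𝔤) (a : UniversalEnvelopingAlgebra ℂ 𝔥)
    (w : W) : Ind.mk 𝔥 σ (u * envelopingIncl 𝔥 a) w =
      Ind.mk 𝔥 σ u (UniversalEnvelopingAlgebra.lift ℂ σ a w) :=
  (Submodule.Quotient.eq _).2 (Submodule.subset_span ⟨u, a, w, rfl⟩)

theorem mk_ι (a : 𝔥) (w : W) :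
    Ind.mk 𝔥 σ (UniversalEnvelopingAlgebra.ι ℂ (a : 𝔤)) w = Ind.mk 𝔥 σ 1 (σ a w) := by
  have h := mk_mul_incl (σ := σ) 1 (UniversalEnvelopingAlgebra.ι ℂ a) w
  rw [one_mul, UniversalEnvelopingAlgebra.lift_ι_apply] at h
  rw [← h, envelopingIncl, UniversalEnvelopingAlgebra.lift_ι_apply]
  rfl

/-- Frobenius reciprocity. -/
theorem exists_linearMap {P : Type*} [AddCommGroup P] [Module ℂ P] (R : 𝔤 →ₗ⁅ℂ⁆ Module.End ℂ P)
    (j : W →ₗ[ℂ] P) (hj : ∀ (a : 𝔥) (w : W), R a (j w) = j (σ a w)) :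
    ∃ F : Ind 𝔥 σ →ₗ[ℂ] P, (∀ w, F (Ind.mk 𝔥 σ 1 w) = j w) ∧
      ∀ (Y : 𝔤) (m : Ind 𝔥 σ), F (UniversalEnvelopingAlgebra.ι ℂ Y • m) = R Y (F m) := by
  let ρ := UniversalEnvelopingAlgebra.lift ℂ R
  let F₀ : UniversalEnvelopingAlgebra ℂ 𝔤 ⊗[ℂ] W →ₗ[ℂ] P :=
    TensorProduct.lift (LinearMap.lcomp ℂ P j ∘ₗ ρ.toLinearMap)
  have hF₀ : ∀ u w, F₀ (u ⊗ₜ w) = ρ u (j w) := fun u w => rfl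
  have hsmul : ∀ u t, F₀ (u • t) = ρ u (F₀ t) := by
    intro u t
    induction t with
    | zero => simp only [smul_zero, map_zero]
    | add s t hs ht => simp only [smul_add, map_add, hs, ht]
    | tmul u' w =>
      rw [TensorProduct.smul_tmul', hF₀, hF₀, smul_eq_mul, map_mul, Module.End.mul_apply]
  -- Equivariance of `j` passes from `𝔥` to `U(𝔥)`, which is what the defining relations require.
  have hincl : ∀ (a : UniversalEnvelopingAlgebra ℂ 𝔥) (w : W),
      ρ (envelopingIncl 𝔥 a) (j w) = j (UniversalEnvelopingAlgebra.lift ℂ σ a w) := by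
    intro a
    induction a using UniversalEnvelopingAlgebra.induction_ι with
    | hι a =>
      intro w
      rw [envelopingIncl, UniversalEnvelopingAlgebra.lift_ι_apply,
        UniversalEnvelopingAlgebra.lift_ι_apply, ← hj a w]
      exact congrArg (fun f : Module.End ℂ P => f (j w))
        (UniversalEnvelopingAlgebra.lift_ι_apply ℂ R (a : 𝔤))
    | halg c =>
      intro w
      rw [AlgHom.commutes, AlgHom.commutes, AlgHom.commutes, Module.algebraMap_end_apply,
        Module.algebraMap_end_apply, map_smul]
    | hadd a b ha hb =>
      intro w
      rw [map_add, map_add, map_add, LinearMap.add_apply, LinearMap.add_apply, ha, hb, map_add]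
    | hmul a b ha hb =>
      intro w
      rw [map_mul, map_mul, map_mul, Module.End.mul_apply, Module.End.mul_apply, hb, ha]
  have hker : (inducedRel 𝔥 σ).restrictScalars ℂ ≤ LinearMap.ker F₀ := by
    intro t ht
    rw [Submodule.restrictScalars_mem] at ht
    induction ht using Submodule.span_induction with
    | mem t ht =>
      obtain ⟨u, a, w, rfl⟩ := ht
      rw [LinearMap.mem_ker, map_sub, hF₀, hF₀, map_mul, Module.End.mul_apply, hincl, sub_self]
    | zero => exact Submodule.zero_mem _
    | add s t _ _ hs ht => exact Submodule.add_mem _ hs ht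
    | smul u t _ ht => rw [LinearMap.mem_ker, hsmul, LinearMap.mem_ker.1 ht, map_zero]
  let F : Ind 𝔥 σ →ₗ[ℂ] P := ((inducedRel 𝔥 σ).restrictScalars ℂ).liftQ F₀ hker ∘ₗ
    (Submodule.Quotient.restrictScalarsEquiv ℂ (inducedRel 𝔥 σ)).symm.toLinearMap
  have hF : ∀ t, F (mkₗ 𝔥 σ t) = F₀ t := fun t => rfl
  refine ⟨F, fun w => ?_, fun Y m => ?_⟩
  · rw [← mkₗ_tmul, hF, hF₀, map_one, Module.End.one_apply]
  · obtain ⟨t, rfl⟩ := mkₗ_surjective m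
    have h1 : UniversalEnvelopingAlgebra.ι ℂ Y • mkₗ 𝔥 σ t =
      mkₗ 𝔥 σ (UniversalEnvelopingAlgebra.ι ℂ Y • t) := rfl
    rw [h1, hF, hF, hsmul]
    exact congrArg (fun f : Module.End ℂ P => f (F₀ t))
      (UniversalEnvelopingAlgebra.lift_ι_apply ℂ R Y)

/-- If `𝔤 = 𝔫 + 𝔥`, then `ind(W)` is spanned by the elements `X₁ ⋯ X_k ⊗ w` with `Xᵢ ∈ 𝔫`. -/
theorem span_prod_eq_top {𝔫 : LieSubalgebra ℂ 𝔤} (h𝔫 : ∀ Y : 𝔤, ∃ (x : 𝔫) (a : 𝔥), (x : 𝔤) + a = Y) :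
    Submodule.span ℂ {m : Ind 𝔥 σ | ∃ (L : List 𝔫) (w : W), m = Ind.mk 𝔥 σ
      (L.map fun X : 𝔫 => UniversalEnvelopingAlgebra.ι ℂ (X : 𝔤)).prod w} = ⊤ := by
  set S := Submodule.span ℂ {m : Ind 𝔥 σ | ∃ (L : List 𝔫) (w : W), m = Ind.mk 𝔥 σ
      (L.map fun X : 𝔫 => UniversalEnvelopingAlgebra.ι ℂ (X : 𝔤)).prod w} with hS
  have hmem : ∀ (L : List 𝔫) (w : W), Ind.mk 𝔥 σ
      (L.map fun X : 𝔫 => UniversalEnvelopingAlgebra.ι ℂ (X : 𝔤)).prod w ∈ S := fun L w =>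
    Submodule.subset_span ⟨L, w, rfl⟩
  have hspan : ∀ u : UniversalEnvelopingAlgebra ℂ 𝔤, (∀ (L : List 𝔫) (w : W), u • Ind.mk 𝔥 σ
      (L.map fun X : 𝔫 => UniversalEnvelopingAlgebra.ι ℂ (X : 𝔤)).prod w ∈ S) →
      ∀ m ∈ S, u • m ∈ S := by
    intro u hu m hm
    induction hm using Submodule.span_induction with
    | mem m hm => obtain ⟨L, w, rfl⟩ := hm; exact hu L w
    | zero => rw [smul_zero]; exact Submodule.zero_mem _
    | add s t _ _ hs ht => rw [smul_add]; exact Submodule.add_mem _ hs ht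
    | smul c t _ ht => rw [smul_comm]; exact Submodule.smul_mem _ _ ht
  have hn : ∀ X : 𝔫, ∀ m ∈ S, UniversalEnvelopingAlgebra.ι ℂ (X : 𝔤) • m ∈ S := fun X =>
    hspan _ fun L w => by
      have := hmem (X :: L) w
      rwa [List.map_cons, List.prod_cons, ← smul_mk] at this
  -- Induction on the word, with `Y` free: in `Y X = X Y + [Y, X]` the bracket is again an arbitrary
  -- element of `𝔤`. On the empty word the `𝔥`-part of `Y` is absorbed into `w`.
  have hg : ∀ (L : List 𝔫) (Y : 𝔤) (w : W), UniversalEnvelopingAlgebra.ι ℂ Y • Ind.mk 𝔥 σ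
      (L.map fun X : 𝔫 => UniversalEnvelopingAlgebra.ι ℂ (X : 𝔤)).prod w ∈ S := by
    intro L
    induction L with
    | nil =>
      intro Y w
      obtain ⟨x, a, rfl⟩ := h𝔫 Y
      rw [map_add, add_smul]
      refine Submodule.add_mem _ (hn x _ (hmem [] w)) ?_
      rw [List.map_nil, List.prod_nil, smul_mk, mul_one, mk_ι]
      exact hmem [] _
    | cons X L ih =>
      intro Y w
      have h1 : UniversalEnvelopingAlgebra.ι ℂ Y * UniversalEnvelopingAlgebra.ι ℂ (X : 𝔤) =
          UniversalEnvelopingAlgebra.ι ℂ (X : 𝔤) * UniversalEnvelopingAlgebra.ι ℂ Y +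
            UniversalEnvelopingAlgebra.ι ℂ ⁅Y, (X : 𝔤)⁆ := by
        rw [LieHom.map_lie, Ring.lie_def]
        abel
      rw [List.map_cons, List.prod_cons, ← smul_mk, ← mul_smul, h1, add_smul, mul_smul]
      exact Submodule.add_mem _ (hn X _ (ih Y w)) (ih _ w)
  have hU : ∀ u : UniversalEnvelopingAlgebra ℂ 𝔤, ∀ m ∈ S, u • m ∈ S := by
    intro u
    induction u using UniversalEnvelopingAlgebra.induction_ι with
    | hι Y => exact hspan _ fun L w => hg L Y w
    | halg c => exact fun m hm => by rw [algebraMap_smul]; exact Submodule.smul_mem _ _ hm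
    | hadd a b ha hb =>
      exact fun m hm => by rw [add_smul]; exact Submodule.add_mem _ (ha m hm) (hb m hm)
    | hmul a b ha hb => exact fun m hm => by rw [mul_smul]; exact ha _ (hb m hm)
  rw [eq_top_iff]
  intro m _
  obtain ⟨t, rfl⟩ := mkₗ_surjective m
  induction t with
  | zero => rw [map_zero]; exact Submodule.zero_mem _
  | add s t hs ht =>
    rw [map_add]
    exact Submodule.add_mem _ (hs Submodule.mem_top) (ht Submodule.mem_top)
  | tmul u w =>
    have h1 := hU u _ (hmem [] w)
    rwa [List.map_nil, List.prod_nil, smul_mk, mul_one, ← mkₗ_tmul] at h1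

end Ind

end InducedModules

/-! ## The Fourier transformed action -/

section FourierAction

variable {E E' : Type*} [AddCommGroup E] [Module ℂ E] [AddCommGroup E'] [Module ℂ E']
  {U W : Type*} [AddCommGroup U] [Module ℂ U] [AddCommGroup W] [Module ℂ W]
  {b : E →ₗ[ℂ] E' →ₗ[ℂ] ℂ} {Φ : Weyl E ≃ₐ[ℂ] Weyl E'}

namespace Weyl

theorem act_hat_tmul (T : Weyl E) (S : Module.End ℂ W) (f : Pol E') (w : W) :
    Weyl.act E' W (Weyl.hat Φ W (T ⊗ₜ[ℂ] S)) (f ⊗ₜ[ℂ] w) = Weyl.toEnd (Φ T) f ⊗ₜ[ℂ] S w := rfl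

theorem act_hat_mulOp (μ : U →ₗ[ℂ] Module.End ℂ W) (f : Pol E) (a : U) (g : Pol E') (w : W) :
    Weyl.act E' W (Weyl.hat Φ W (mulOp μ (f ⊗ₜ[ℂ] a))) (g ⊗ₜ[ℂ] w) =
      Weyl.toEnd (Φ (pol E f)) g ⊗ₜ[ℂ] μ a w := rfl

/-- In `f ∂_v` the coefficient stands on the left, so after the transform the differentiation acts
after the multiplication by `b v`. This order is the origin of the trace term. -/
theorem act_hat_vecOp (hΦ : IsAlgFourier b Φ) (f : Pol E) (v : E) (g : Pol E') (w : W) :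
    Weyl.act E' W (Weyl.hat Φ W (vecOp (f ⊗ₜ[ℂ] v) ⊗ₜ[ℂ] 1)) (g ⊗ₜ[ℂ] w) =
      -(Weyl.toEnd (Φ (pol E f)) (Pol.lin (b v) * g) ⊗ₜ[ℂ] w) := by
  rw [act_hat_tmul, vecOp_tmul, map_mul, hΦ.1, map_mul, Module.End.mul_apply, map_neg,
    LinearMap.neg_apply, toEnd_mul, map_neg, TensorProduct.neg_tmul]
  rfl

theorem toEnd_fourier_lin (hΦ : IsAlgFourier b Φ) {l : Module.Dual ℂ E} {y : E'}
    (hy : b.flip y = l) (g : Pol E') :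
    Weyl.toEnd (Φ (pol E (Pol.lin l))) g = Pol.partialDeriv y g := by
  rw [pol_lin, ← hy, hΦ.2, toEnd_partialDeriv]

end Weyl

end FourierAction

/-! ## The intertwining map -/

section Intertwining

variable {𝔤 : Type*} [LieRing 𝔤] [LieAlgebra ℂ 𝔤] [FiniteDimensional ℂ 𝔤]
  {B : LinearMap.BilinForm ℂ 𝔤} {H : 𝔤}

namespace HasAbelianNilradicals

theorem isPerfPair (h : HasAbelianNilradicals B H) : (pairing H B).IsPerfPair :=
  pairing_isPerfPair h.symm h.inv h.sep h.hyp

/-- The basis of `𝔫₊` dual to the chosen basis of `𝔫₋`. -/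
def dualBasis (h : HasAbelianNilradicals B H) :
    Module.Basis (Fin (Module.finrank ℂ (nMinus H))) ℂ (nPlus H) :=
  have := h.isPerfPair
  (Module.finBasis ℂ (nMinus H)).dualBasis.map (pairing H B).flip.toPerfPair.symm

theorem pairing_flip_dualBasis (h : HasAbelianNilradicals B H)
    (i : Fin (Module.finrank ℂ (nMinus H))) :
    (pairing H B).flip (h.dualBasis i) = (Module.finBasis ℂ (nMinus H)).coord i := by
  have := h.isPerfPair
  rw [dualBasis, Module.Basis.map_apply, Module.Basis.coe_dualBasis]
  exact (pairing H B).flip.toPerfPair.apply_symm_apply _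

theorem pairing_dualBasis (h : HasAbelianNilradicals B H)
    (i j : Fin (Module.finrank ℂ (nMinus H))) :
    pairing H B (Module.finBasis ℂ (nMinus H) i) (h.dualBasis j) = if i = j then 1 else 0 := by
  have h1 := congrArg (fun f : nMinus H →ₗ[ℂ] ℂ => f (Module.finBasis ℂ (nMinus H) i))
    (h.pairing_flip_dualBasis j)
  rw [← Finsupp.single_apply]
  simpa using h1

theorem adExpNegPol_nMinus (h : HasAbelianNilradicals B H) (x : nMinus H) :
    adExpNegPol H (x : 𝔤) = 1 ⊗ₜ[ℂ] (x : 𝔤) := by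
  simp only [adExpNegPol_apply, h.minus _ (Module.finBasis ℂ (nMinus H) _).2 _ x.2, lie_zero,
    TensorProduct.tmul_zero, Finset.sum_const_zero, smul_zero, sub_zero, add_zero]

theorem adExpNegPol_levi (h : HasAbelianNilradicals B H) (a : levi H) :
    adExpNegPol H (a : 𝔤) = 1 ⊗ₜ[ℂ] (a : 𝔤) -
      ∑ i, Pol.lin ((Module.finBasis ℂ (nMinus H)).coord i) ⊗ₜ[ℂ]
        ⁅(Module.finBasis ℂ (nMinus H) i : 𝔤), (a : 𝔤)⁆ := by
  simp only [adExpNegPol_apply, h.minus _ (Module.finBasis ℂ (nMinus H) _).2 _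
    (lie_nMinus_levi_mem _ a), TensorProduct.tmul_zero, Finset.sum_const_zero, smul_zero, add_zero]

variable {V : Type*} [AddCommGroup V] [Module ℂ V] [LieRingModule (levi H) V]
  [LieModule ℂ (levi H) V] {Φ : Weyl (nMinus H) ≃ₐ[ℂ] Weyl (nPlus H)}

/-- For `x ∈ 𝔫₋` the operator `dπ_μ(x)` is `-∂_x`, and the two signs cancel. -/
theorem act_hat_principalSeries_nMinus (h : HasAbelianNilradicals B H)
    (hΦ : IsAlgFourier (pairing H B) Φ) (x : nMinus H) (f : Pol (nPlus H)) (v : Module.Dual ℂ V) :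
    Weyl.act _ _ (Weyl.hat Φ _ (h.principalSeries V x)) (f ⊗ₜ[ℂ] v) =
      (Pol.lin (pairing H B x) * f) ⊗ₜ[ℂ] v := by
  rw [principalSeries_apply, Weyl.op, h.adExpNegPol_nMinus, LinearMap.lTensor_tmul,
    LinearMap.lTensor_tmul, projLevi_nMinus, projMinus_coe, map_sub, map_sub, LinearMap.sub_apply,
    Weyl.act_hat_mulOp, Weyl.act_hat_vecOp hΦ]
  simp only [map_zero, LinearMap.zero_apply, TensorProduct.tmul_zero, map_one,
    Module.End.one_apply, zero_sub, neg_neg]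

/-- The vector field is linear, so its transform multiplies `1` by a linear function and
differentiates it once. The resulting constants sum to the trace that `μ` adds to `λ^∨`, with
opposite sign; this is why the twist is by `Λ^{top} 𝔫₊`. -/
theorem act_hat_principalSeries_levi (h : HasAbelianNilradicals B H)
    (hΦ : IsAlgFourier (pairing H B) Φ) (a : levi H) (v : Module.Dual ℂ V) :
    Weyl.act _ _ (Weyl.hat Φ _ (h.principalSeries V a)) (1 ⊗ₜ[ℂ] v) =
      1 ⊗ₜ[ℂ] LieModule.toEnd ℂ (levi H) (Module.Dual ℂ V) a v := by
  have e1 : ∀ i, projLevi h.hyp ⁅(Module.finBasis ℂ (nMinus H) i : 𝔤), (a : 𝔤)⁆ = 0 := fun i =>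
    projLevi_nMinus h.hyp ⟨_, lie_nMinus_levi_mem _ a⟩
  have e2 : ∀ i, Weyl.toEnd (Φ (Weyl.pol _ (Pol.lin ((Module.finBasis ℂ (nMinus H)).coord i))))
      (Pol.lin (pairing H B (projMinus h.hyp ⁅(Module.finBasis ℂ (nMinus H) i : 𝔤), (a : 𝔤)⁆)) * 1)
      = -(B ⁅(a : 𝔤), (Module.finBasis ℂ (nMinus H) i : 𝔤)⁆ (h.dualBasis i)) •
        (1 : Pol (nPlus H)) := by
    intro i
    have h1 : projMinus h.hyp ⁅(Module.finBasis ℂ (nMinus H) i : 𝔤), (a : 𝔤)⁆ =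
        ⟨_, lie_nMinus_levi_mem (Module.finBasis ℂ (nMinus H) i) a⟩ :=
      projMinus_coe h.hyp ⟨_, lie_nMinus_levi_mem _ a⟩
    rw [Weyl.toEnd_fourier_lin hΦ (h.pairing_flip_dualBasis i), mul_one, Pol.partialDeriv_lin, h1,
      Algebra.algebraMap_eq_smul_one]
    congr 1
    change B ⁅(Module.finBasis ℂ (nMinus H) i : 𝔤), (a : 𝔤)⁆ (h.dualBasis i) = _
    rw [← lie_skew, map_neg, LinearMap.neg_apply]
  rw [principalSeries_apply, Weyl.op, h.adExpNegPol_levi]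
  simp only [map_sub, map_sum, LinearMap.lTensor_tmul, projLevi_of_mem, e1, projMinus_levi,
    LinearMap.sub_apply, LinearMap.sum_apply, TensorProduct.sub_tmul, TensorProduct.sum_tmul,
    Weyl.act_hat_mulOp, Weyl.act_hat_vecOp hΦ, e2, map_zero,
    TensorProduct.tmul_zero, map_one, Module.End.one_apply, Finset.sum_const_zero, sub_zero]
  rw [muRepₗ_apply, muRep, trace_adNPlus_eq h.inv _ h.dualBasis h.pairing_dualBasis a,
    LinearMap.add_apply, TensorProduct.tmul_add]
  simp only [LinearMap.smul_apply, Module.End.one_apply, neg_smul,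
    TensorProduct.neg_tmul, ← TensorProduct.smul_tmul', Finset.sum_neg_distrib, ← Finset.sum_smul]
  rw [TensorProduct.tmul_neg, TensorProduct.tmul_smul, TensorProduct.zero_tmul, map_zero, map_zero,
    LinearMap.zero_apply, zero_sub, neg_neg, sub_neg_eq_add, neg_add_cancel_right]

/-- The potential is linear, so its transform differentiates `1`; the field is quadratic, so its
transform differentiates a linear function twice. -/
theorem act_hat_principalSeries_nPlus (h : HasAbelianNilradicals B H)
    (hΦ : IsAlgFourier (pairing H B) Φ) (y : nPlus H) (v : Module.Dual ℂ V) :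
    Weyl.act _ _ (Weyl.hat Φ _ (h.principalSeries V y)) (1 ⊗ₜ[ℂ] v) = 0 := by
  have e1 : ∀ i, projMinus h.hyp ⁅(Module.finBasis ℂ (nMinus H) i : 𝔤), (y : 𝔤)⁆ = 0 := fun i =>
    projMinus_levi h.hyp ⟨_, h.lie_nMinus_nPlus_mem _ y⟩
  have e2 : ∀ i j, projLevi h.hyp ⁅(Module.finBasis ℂ (nMinus H) i : 𝔤),
      ⁅(Module.finBasis ℂ (nMinus H) j : 𝔤), (y : 𝔤)⁆⁆ = 0 := fun i j =>
    projLevi_nMinus h.hyp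
      ⟨_, lie_nMinus_levi_mem _ ⟨_, h.lie_nMinus_nPlus_mem (Module.finBasis ℂ (nMinus H) j) y⟩⟩
  have e3 : ∀ i f, Weyl.toEnd (Φ (Weyl.pol _ (Pol.lin ((Module.finBasis ℂ (nMinus H)).coord i)))) f
      = Pol.partialDeriv (h.dualBasis i) f := fun i =>
    Weyl.toEnd_fourier_lin hΦ (h.pairing_flip_dualBasis i)
  rw [principalSeries_apply, Weyl.op, adExpNegPol_apply]
  simp only [map_sub, map_add, map_smul, map_sum, LinearMap.lTensor_tmul, projLevi_nPlus, e1, e2,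
    projMinus_nPlus, LinearMap.sub_apply, LinearMap.add_apply, LinearMap.smul_apply,
    LinearMap.sum_apply, TensorProduct.add_tmul, TensorProduct.sum_tmul,
    ← TensorProduct.smul_tmul', Weyl.act_hat_mulOp, Weyl.act_hat_vecOp hΦ, map_mul,
    Module.End.mul_apply, e3, mul_one, Pol.partialDeriv_lin, Pol.partialDeriv_algebraMap,
    Pol.partialDeriv_one, map_zero, LinearMap.zero_apply, TensorProduct.zero_tmul,
    TensorProduct.tmul_zero, Finset.sum_const_zero, smul_zero, sub_zero, neg_zero, add_zero]

theorem act_hat_principalSeries_parabolic (h : HasAbelianNilradicals B H)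
    (hΦ : IsAlgFourier (pairing H B) Φ) (p : parabolic H) (v : Module.Dual ℂ V) :
    Weyl.act _ _ (Weyl.hat Φ _ (h.principalSeries V p)) (1 ⊗ₜ[ℂ] v) =
      1 ⊗ₜ[ℂ] inflatedDual h.hyp V p v := by
  obtain ⟨p, hp⟩ := p
  obtain ⟨a, ha, y, hy, rfl⟩ := exists_of_mem_parabolic hp
  have h1 : inflatedDual h.hyp V ⟨a + y, hp⟩ v =
      LieModule.toEnd ℂ (levi H) (Module.Dual ℂ V) (projLevi h.hyp (a + y)) v := rfl
  have h2 : projLevi h.hyp (a + y) = ⟨a, ha⟩ := by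
    rw [map_add, projLevi_of_mem_nPlus h.hyp hy, add_zero]
    exact projLevi_of_mem h.hyp ⟨a, ha⟩
  rw [h1, h2, map_add, map_add, map_add, LinearMap.add_apply,
    h.act_hat_principalSeries_levi hΦ ⟨a, ha⟩, h.act_hat_principalSeries_nPlus hΦ ⟨y, hy⟩, add_zero]

variable (V) in
/-- The isomorphism `ind(λ^∨) ≃ Pol(𝔫₊) ⊗ V^∨`. -/
theorem existsUnique_intertwiner (h : HasAbelianNilradicals B H)
    (hΦ : IsAlgFourier (pairing H B) Φ) :
    ∃! F_c : Ind (parabolic H) (inflatedDual h.hyp V) ≃ₗ[ℂ] Pol (nPlus H) ⊗[ℂ] Module.Dual ℂ V,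
      (∀ (L : List (nMinus H)) (v : Module.Dual ℂ V),
        F_c (Ind.mk (parabolic H) (inflatedDual h.hyp V)
            (L.map fun X : nMinus H => UniversalEnvelopingAlgebra.ι ℂ (X : 𝔤)).prod v) =
          (L.map fun X : nMinus H => Pol.lin (pairing H B X)).prod ⊗ₜ[ℂ] v) ∧
      ∀ (Y : 𝔤) (m : Ind (parabolic H) (inflatedDual h.hyp V)),
        F_c (UniversalEnvelopingAlgebra.ι ℂ Y • m) =
          Weyl.act _ _ (Weyl.hat Φ _ (h.principalSeries V Y)) (F_c m) := by
  have := h.isPerfPair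
  -- The vectors `1 ⊗ v` transform under `𝔭` by the inflated dual representation, as Frobenius
  -- reciprocity demands.
  obtain ⟨F, hF1, hFY⟩ := Ind.exists_linearMap (σ := inflatedDual h.hyp V)
    ((((Weyl.act (nPlus H) (Module.Dual ℂ V)).comp (Weyl.hat Φ _)).toLieHom).comp
      (h.principalSeries V)) (TensorProduct.mk ℂ (Pol (nPlus H)) (Module.Dual ℂ V) 1)
    fun p v => h.act_hat_principalSeries_parabolic hΦ p v
  replace hFY : ∀ (Y : 𝔤) (m : Ind (parabolic H) (inflatedDual h.hyp V)),
      F (UniversalEnvelopingAlgebra.ι ℂ Y • m) =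
        Weyl.act _ _ (Weyl.hat Φ _ (h.principalSeries V Y)) (F m) := hFY
  have hFL : ∀ (L : List (nMinus H)) (v : Module.Dual ℂ V),
      F (Ind.mk (parabolic H) (inflatedDual h.hyp V)
          (L.map fun X : nMinus H => UniversalEnvelopingAlgebra.ι ℂ (X : 𝔤)).prod v) =
        (L.map fun X : nMinus H => Pol.lin (pairing H B X)).prod ⊗ₜ[ℂ] v := by
    intro L v
    induction L with
    | nil => exact hF1 v
    | cons X L ih =>
      rw [List.map_cons, List.prod_cons, ← Ind.smul_mk, hFY, ih,
        h.act_hat_principalSeries_nMinus hΦ, List.map_cons, List.prod_cons]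
  -- Through `B`, functionals on `𝔫₊` are elements of `𝔫₋`; these commute in `U(𝔤)`, so `Pol(𝔫₊)`
  -- maps to `U(𝔤)`. The inverse `G` of `F` is built from this map.
  obtain ⟨J, hJ⟩ := Pol.exists_algHom (E := nPlus H)
    ((UniversalEnvelopingAlgebra.ι ℂ : 𝔤 →ₗ⁅ℂ⁆ UniversalEnvelopingAlgebra ℂ 𝔤).toLinearMap ∘ₗ
      (nMinus H).incl.toLinearMap ∘ₗ (pairing H B).toPerfPair.symm.toLinearMap) (by
    intro l l'
    rw [commute_iff_lie_eq]
    refine (LieHom.map_lie (UniversalEnvelopingAlgebra.ι ℂ) _ _).symm.trans ?_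
    exact (congrArg (UniversalEnvelopingAlgebra.ι ℂ) (h.minus _ ((pairing H B).toPerfPair.symm l).2 _
      ((pairing H B).toPerfPair.symm l').2)).trans (map_zero _))
  have hJ' : ∀ X : nMinus H, J (Pol.lin (pairing H B X)) =
      UniversalEnvelopingAlgebra.ι ℂ (X : 𝔤) := by
    intro X
    rw [hJ]
    change UniversalEnvelopingAlgebra.ι ℂ (((pairing H B).toPerfPair.symm (pairing H B X) :
      nMinus H) : 𝔤) = _
    congr 2
    exact (pairing H B).toPerfPair.symm_apply_apply X
  let G := Ind.mkₗ (parabolic H) (inflatedDual h.hyp V) ∘ₗ J.toLinearMap.rTensor (Module.Dual ℂ V)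
  have hG : ∀ (L : List (nMinus H)) (v : Module.Dual ℂ V),
      G ((L.map fun X : nMinus H => Pol.lin (pairing H B X)).prod ⊗ₜ[ℂ] v) =
        Ind.mk (parabolic H) (inflatedDual h.hyp V)
          (L.map fun X : nMinus H => UniversalEnvelopingAlgebra.ι ℂ (X : 𝔤)).prod v := by
    intro L v
    change Ind.mk _ _ (J _) v = _
    rw [map_list_prod, List.map_map]
    congr 3
    exact funext hJ'
  have hspan := Ind.span_prod_eq_top (𝔫 := nMinus H) (σ := inflatedDual h.hyp V) (by
    intro Y
    obtain ⟨x, a, y, rfl⟩ := exists_triangular_decomposition h.hyp Y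
    exact ⟨x, ⟨(a : 𝔤) + y, add_mem (levi_le_parabolic a) (nPlus_le_parabolic y)⟩,
      (add_assoc _ _ _).symm⟩)
  have hGF : G ∘ₗ F = LinearMap.id := by
    refine LinearMap.ext_on hspan ?_
    rintro _ ⟨L, v, rfl⟩
    rw [LinearMap.comp_apply, hFL, hG, LinearMap.id_apply]
  have hFG : F ∘ₗ G = LinearMap.id := by
    -- Products of functionals, including the empty product `1`, span the polynomial functions.
    have hlist : ∀ f : Pol (nPlus H), f ∈ Submodule.span ℂ
        (Set.range fun L : List (nMinus H) =>
          (L.map fun X : nMinus H => Pol.lin (pairing H B X)).prod) := by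
      intro f
      induction f using Pol.induction with
      | lin l =>
        refine Submodule.subset_span ⟨[(pairing H B).toPerfPair.symm l], ?_⟩
        dsimp only
        rw [List.map_singleton, List.prod_singleton]
        congr 1
        exact (pairing H B).toPerfPair.apply_symm_apply l
      | algebraMap c =>
        rw [Algebra.algebraMap_eq_smul_one]
        exact Submodule.smul_mem _ _ (Submodule.subset_span ⟨[], rfl⟩)
      | add f g hf hg => exact Submodule.add_mem _ hf hg
      | mul f g hf hg =>
        have h1 := Submodule.mul_mem_mul hf hg
        rw [Submodule.span_mul_span] at h1
        refine Submodule.span_mono ?_ h1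
        rintro _ ⟨_, ⟨L, rfl⟩, _, ⟨L', rfl⟩, rfl⟩
        exact ⟨L ++ L', by simp⟩
    refine TensorProduct.ext' fun f v => ?_
    have h1 := hlist f
    induction h1 using Submodule.span_induction with
    | mem f hf =>
      obtain ⟨L, rfl⟩ := hf
      rw [LinearMap.comp_apply, hG, hFL, LinearMap.id_apply]
    | zero => rw [TensorProduct.zero_tmul, map_zero, map_zero]
    | add f g _ _ hf hg => rw [TensorProduct.add_tmul, map_add, map_add, hf, hg]
    | smul c f _ hf => rw [← TensorProduct.smul_tmul', map_smul, map_smul, hf]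
  refine ⟨LinearEquiv.ofLinearMap F G hFG hGF, ⟨hFL, hFY⟩, ?_⟩
  rintro F' ⟨hF', -⟩
  -- The values on the spanning products already determine the map.
  refine LinearEquiv.toLinearMap_injective (LinearMap.ext_on hspan ?_)
  rintro _ ⟨L, v, rfl⟩
  exact (hF' L v).trans (hFL L v).symm

end HasAbelianNilradicals

end Intertwining

end

theorem mainTheorem2 {𝔤 : Type*} [LieRing 𝔤] [LieAlgebra ℂ 𝔤] [FiniteDimensional ℂ 𝔤]
    [LieAlgebra.HasCentralRadical ℂ 𝔤]
    (B : LinearMap.BilinForm ℂ 𝔤) (hBsymm : B.IsSymm) (hBinv : B.lieInvariant 𝔤)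
    (hBnondeg : B.Nondegenerate)
    (H : 𝔤) (hH : IsHyperbolic H) (habelian : ∀ x ∈ nPlus H, ∀ y ∈ nPlus H, ⁅x, y⁆ = 0)
    (V : Type*) [AddCommGroup V] [Module ℂ V] [LieRingModule (levi H) V]
    [LieModule ℂ (levi H) V] :
    (∃! Φ : Weyl (nMinus H) ≃ₐ[ℂ] Weyl (nPlus H), IsAlgFourier (pairing H B) Φ) ∧
    (∃! dπ : 𝔤 →ₗ⁅ℂ⁆ Weyl (nMinus H) ⊗[ℂ] Module.End ℂ (Module.Dual ℂ V),
      IsPrincipalSeriesAction hH V dπ) ∧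
    ∀ (Φ : Weyl (nMinus H) ≃ₐ[ℂ] Weyl (nPlus H))
      (dπ : 𝔤 →ₗ⁅ℂ⁆ Weyl (nMinus H) ⊗[ℂ] Module.End ℂ (Module.Dual ℂ V)),
      IsAlgFourier (pairing H B) Φ → IsPrincipalSeriesAction hH V dπ →
      ∃! F_c : Ind (parabolic H) (inflatedDual hH V) ≃ₗ[ℂ]
          Pol (nPlus H) ⊗[ℂ] Module.Dual ℂ V,
        (∀ (L : List (nMinus H)) (v : Module.Dual ℂ V),
          F_c (Ind.mk (parabolic H) (inflatedDual hH V)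
              (L.map fun X : nMinus H => UniversalEnvelopingAlgebra.ι ℂ (X : 𝔤)).prod v) =
            (L.map fun X : nMinus H => Pol.lin (pairing H B X)).prod ⊗ₜ[ℂ] v) ∧
        ∀ (Y : 𝔤) (m : Ind (parabolic H) (inflatedDual hH V)),
          F_c (UniversalEnvelopingAlgebra.ι ℂ Y • m) =
            Weyl.act _ _ (Weyl.hat Φ _ (dπ Y)) (F_c m) := by
  -- Reductivity enters only here, through the commutativity of `𝔫₋`.
  have h : HasAbelianNilradicals B H :=
    { symm := fun x y => hBsymm.eq x y
      inv := hBinv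
      sep := hBnondeg.1
      hyp := hH
      plus := habelian
      minus := nMinus_abelian hBinv hBnondeg.1 hH habelian }
  refine ⟨existsUnique_isAlgFourier _ h.isPerfPair, ⟨h.principalSeries V,
    h.isPrincipalSeriesAction_principalSeries V, fun dπ hdπ =>
      hdπ.unique (h.isPrincipalSeriesAction_principalSeries V)⟩, fun Φ dπ hΦ hdπ => ?_⟩
  rw [hdπ.unique (h.isPrincipalSeriesAction_principalSeries V)]
  exact h.existsUnique_intertwiner V hΦ
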